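/- Let $K$ be a field of characteristic different from $2$, $K^s$ a separable closure of $K$ and $G_K=\mathrm{Gal}(K^s/K)$. Let $G$ be a finite group and let $L/K$ be a $G$-Galois algebra, that is, an étale $K$-algebra of degree $|G|$ with an action of $G$ by $K$-algebra automorphisms such that the induced action of $G$ on the set of $K$-algebra homomorphisms $L\to K^s$ is simply transitive. Let $q_L\colon L\to K$, $q_L(x)=\mathrm{Tr}_{L/K}(x^2)$, be its trace form; it is non-degenerate, hence has a diagonalisation. For any diagonalisation $q_L\simeq\langle a_1,\dots,a_n\rangle$ with $a_i\in K^\times$, the first two Hasse-Witt invariants of $q_L$ are $$w_1(q_L)=\sum_i (a_i)\in H^1(G_K,\mathbf Z/2\mathbf Z),\qquad w_2(q_L)=\sum_{i<j}(a_i)\cdot(a_j)\in H^2(G_K,\mathbf Z/2\mathbf Z),$$ where $(a)\in H^1(G_K,\mathbf Z/2\mathbf Z)$ is the class of $a\in K^\times$ under $K^\times/(K^\times)^2\simeq H^1(G_K,\mathbf Z/2\mathbf Z)$ and the product is the cup product (these invariants do not depend on the diagonalisation). Let $S$ be a Sylow $2$-subgroup of $G$. Suppose that $S$ is the direct product of two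 non-trivial subgroups $G_1$ and $G_2$, at least one of which is non-cyclic. Then $$w_1(q_L)=w_2(q_L)=0.$$ The same equalities hold if $S$ is abelian and non-metacyclic, i.e. abelian with no cyclic (normal) subgroup $N$ such that $S/N$ is cyclic. -/

import Mathlib

/-! ### Continuous cohomology of a topological group in degrees one and two

Coefficients are `ZMod 2` with the discrete topology and the trivial action; the cochains are the
usual inhomogeneous continuous ones. -/

/-- `H¹(Γ, ℤ/2ℤ)`. The action is trivial, so the one-coboundaries vanish and `H¹` is the group of
continuous one-cocycles, that is, of continuous homomorphisms `Γ → ℤ/2ℤ`. -/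
def contH1 (Γ : Type*) [Group Γ] [TopologicalSpace Γ] : AddSubgroup (Γ → ZMod 2) where
  carrier := {f | Continuous f ∧ ∀ g h, f (g * h) = f g + f h}
  zero_mem' := ⟨continuous_const, by simp⟩
  add_mem' := by
    rintro a b ⟨ha, ha'⟩ ⟨hb, hb'⟩
    refine ⟨ha.add hb, fun g h => ?_⟩
    simp only [Pi.add_apply, ha', hb']
    ring
  neg_mem' := by
    rintro a ⟨ha, ha'⟩
    refine ⟨ha.neg, fun g h => ?_⟩
    simp only [Pi.neg_apply, ha']
    ring

/-- Continuous two-cocycles `Γ × Γ → ℤ/2ℤ`. -/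
def contZ2 (Γ : Type*) [Group Γ] [TopologicalSpace Γ] : AddSubgroup (Γ × Γ → ZMod 2) where
  carrier := {f | Continuous f ∧
    ∀ g h j, f (h, j) - f (g * h, j) + f (g, h * j) - f (g, h) = 0}
  zero_mem' := ⟨continuous_const, by simp⟩
  add_mem' := by
    rintro a b ⟨ha, ha'⟩ ⟨hb, hb'⟩
    refine ⟨ha.add hb, fun g h j => ?_⟩
    have h1 := ha' g h j
    have h2 := hb' g h j
    simp only [Pi.add_apply]
    linear_combination h1 + h2
  neg_mem' := by
    rintro a ⟨ha, ha'⟩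
    refine ⟨ha.neg, fun g h j => ?_⟩
    have h1 := ha' g h j
    simp only [Pi.neg_apply]
    linear_combination -h1

/-- Two-coboundaries of continuous one-cochains. -/
def contB2 (Γ : Type*) [Group Γ] [TopologicalSpace Γ] : AddSubgroup (Γ × Γ → ZMod 2) where
  carrier := {f | ∃ c : Γ → ZMod 2, Continuous c ∧
    ∀ g h, f (g, h) = c h - c (g * h) + c g}
  zero_mem' := ⟨0, continuous_const, by simp⟩
  add_mem' := by
    rintro a b ⟨c, hc, hc'⟩ ⟨d, hd, hd'⟩
    refine ⟨c + d, hc.add hd, fun g h => ?_⟩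
    simp only [Pi.add_apply, hc', hd']
    ring
  neg_mem' := by
    rintro a ⟨c, hc, hc'⟩
    refine ⟨-c, hc.neg, fun g h => ?_⟩
    simp only [Pi.neg_apply, hc']
    ring

/-- `H²(Γ, ℤ/2ℤ)`: continuous two-cocycles modulo two-coboundaries. -/
abbrev contH2 (Γ : Type*) [Group Γ] [TopologicalSpace Γ] : Type _ :=
  contZ2 Γ ⧸ (contB2 Γ).addSubgroupOf (contZ2 Γ)

/-- The cup product `H¹ × H¹ → H²`: the class of `(g, h) ↦ χ g * ψ h`. -/
def cupH1 {Γ : Type*} [Group Γ] [TopologicalSpace Γ] (χ ψ : contH1 Γ) : contH2 Γ :=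
  QuotientAddGroup.mk ⟨fun p => χ.1 p.1 * ψ.1 p.2,
    (χ.2.1.comp continuous_fst).mul (ψ.2.1.comp continuous_snd), fun g h j => by
      simp only [χ.2.2, ψ.2.2]
      ring⟩

/-! ### The class `(a) ∈ H¹(G_K, ℤ/2ℤ)` of `a ∈ Kˣ` -/

open Classical in
/-- The homomorphism `G_K → ℤ/2ℤ` cut out by `√a`: it is `0` at `σ` exactly when `σ` fixes the
square roots of `a` in `Ks`. -/
noncomputable def kummerFun {K : Type*} (Ks : Type*) [Field K] [Field Ks] [Algebra K Ks]
    (a : Kˣ) (σ : Ks ≃ₐ[K] Ks) : ZMod 2 :=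
  if ∀ s : Ks, s ^ 2 = algebraMap K Ks a → σ s = s then 0 else 1

theorem kummerFun_eq {K : Type*} (Ks : Type*) [Field K] [Field Ks] [Algebra K Ks]
    (a : Kˣ) {s : Ks} (hs : s ^ 2 = algebraMap K Ks a) (σ : Ks ≃ₐ[K] Ks) [Decidable (σ s = s)] :
    kummerFun Ks a σ = if σ s = s then 0 else 1 := by
  have key : (∀ t : Ks, t ^ 2 = algebraMap K Ks a → σ t = t) ↔ σ s = s := by
    refine ⟨fun h => h s hs, fun h t ht => ?_⟩
    rcases sq_eq_sq_iff_eq_or_eq_neg.1 (ht.trans hs.symm) with rfl | rfl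
    · exact h
    · rw [map_neg, h]
  unfold kummerFun
  by_cases h : σ s = s
  · rw [if_pos (key.2 h), if_pos h]
  · rw [if_neg (fun h' => h (key.1 h')), if_neg h]

theorem kummerFun_mem {K : Type*} (Ks : Type*) [Field K] [Field Ks] [Algebra K Ks]
    [IsSepClosure K Ks] (a : Kˣ) : kummerFun Ks a ∈ contH1 (Ks ≃ₐ[K] Ks) := by
  classical
  have hsep : Algebra.IsSeparable K Ks := IsSepClosure.separable
  by_cases hex : ∃ s : Ks, s ^ 2 = algebraMap K Ks a
  · obtain ⟨s, hs⟩ := hex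
    have pm : ∀ σ : Ks ≃ₐ[K] Ks, σ s = s ∨ σ s = -s := fun σ => by
      apply sq_eq_sq_iff_eq_or_eq_neg.1
      rw [← map_pow, hs, AlgEquiv.commutes]
    have hom : ∀ g h, kummerFun Ks a (g * h) = kummerFun Ks a g + kummerFun Ks a h := by
      intro g h
      simp only [kummerFun_eq Ks a hs, AlgEquiv.mul_apply]
      by_cases hg : g s = s <;> by_cases hh : h s = s
      · simp [hg, hh]
      · have h1 := (pm h).resolve_left hh
        have h2 : ¬ -s = s := fun h' => hh (h1.trans h')
        simp [hg, h1, h2]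
      · simp [hg, hh]
      · have h1 := (pm h).resolve_left hh
        have h2 := (pm g).resolve_left hg
        have h3 : ¬ -s = s := fun h' => hh (h1.trans h')
        simp only [h1, map_neg, h2, neg_neg, if_true, if_neg h3]
        decide
    refine ⟨?_, hom⟩
    have hfd : FiniteDimensional K (IntermediateField.adjoin K {s}) :=
      IntermediateField.adjoin.finiteDimensional (Algebra.IsIntegral.isIntegral s)
    refine IsLocallyConstant.continuous ((IsLocallyConstant.iff_exists_open _).2 fun g => ?_)
    let U := (IntermediateField.adjoin K {s}).fixingSubgroup
    have hU : IsOpen (U : Set (Ks ≃ₐ[K] Ks)) := IntermediateField.fixingSubgroup_isOpen _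
    refine ⟨(fun x => g⁻¹ * x) ⁻¹' (U : Set (Ks ≃ₐ[K] Ks)),
      hU.preimage (continuous_const_mul _), by simp [U.one_mem], fun x hx => ?_⟩
    have hx' : (g⁻¹ * x) s = s :=
      (IntermediateField.mem_fixingSubgroup_iff _ _).1 hx s
        (IntermediateField.mem_adjoin_simple_self K s)
    have h0 : kummerFun Ks a (g⁻¹ * x) = 0 := by rw [kummerFun_eq Ks a hs, if_pos hx']
    have h1 := hom g (g⁻¹ * x)
    rwa [mul_inv_cancel_left, h0, add_zero] at h1
  · have h0 : kummerFun Ks a = 0 := by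
      funext σ
      exact if_pos fun s hs => absurd ⟨s, hs⟩ hex
    rw [h0]
    exact zero_mem _

/-- The class `(a) ∈ H¹(G_K, ℤ/2ℤ)` of `a ∈ Kˣ`, where `G_K = Gal(Ks/K)`. -/
noncomputable def kummerClass {K : Type*} (Ks : Type*) [Field K] [Field Ks] [Algebra K Ks]
    [IsSepClosure K Ks] (a : Kˣ) : contH1 (Ks ≃ₐ[K] Ks) :=
  ⟨kummerFun Ks a, kummerFun_mem Ks a⟩

/-! ### Hasse-Witt invariants of degrees one and two -/

/-- `⟨a₁, …, aₙ⟩` is a diagonalisation of `q`. -/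
def IsDiagonalisation {K V : Type*} [Field K] [AddCommGroup V] [Module K V]
    (q : QuadraticForm K V) {n : ℕ} (a : Fin n → Kˣ) : Prop :=
  q.Equivalent (QuadraticMap.weightedSumSquares K fun i => (a i : K))

/-- The first Hasse-Witt invariant of `⟨a₁, …, aₙ⟩`. -/
noncomputable def hasseWittOne {K : Type*} (Ks : Type*) [Field K] [Field Ks] [Algebra K Ks]
    [IsSepClosure K Ks] {n : ℕ} (a : Fin n → Kˣ) : contH1 (Ks ≃ₐ[K] Ks) :=
  ∑ i, kummerClass Ks (a i)

/-- The second Hasse-Witt invariant of `⟨a₁, …, aₙ⟩`: the sum of `(aᵢ) ∪ (aⱼ)` over `i < j`. -/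
noncomputable def hasseWittTwo {K : Type*} (Ks : Type*) [Field K] [Field Ks] [Algebra K Ks]
    [IsSepClosure K Ks] {n : ℕ} (a : Fin n → Kˣ) : contH2 (Ks ≃ₐ[K] Ks) :=
  ∑ i, ∑ j ∈ Finset.Ioi i, cupH1 (kummerClass Ks (a i)) (kummerClass Ks (a j))

/-! ### Galois algebras and their trace forms -/

/-- `L` is a `G`-Galois algebra over `K`: an étale `K`-algebra of degree `|G|` on which `G` acts by
`K`-algebra automorphisms, so that the induced (right) action `χ ↦ χ ∘ g` on the set of `K`-algebra
homomorphisms `L → Ks` is simply transitive. -/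
structure IsGaloisAlgebra (K Ks G L : Type*) [Field K] [Field Ks] [Algebra K Ks] [Group G]
    [CommRing L] [Algebra K L] [MulSemiringAction G L] : Prop where
  etale : Algebra.Etale K L
  finrank_eq : Module.finrank K L = Nat.card G
  smul_algebraMap : ∀ (g : G) (x : K), g • algebraMap K L x = algebraMap K L x
  simply_transitive : ∀ χ χ' : L →ₐ[K] Ks, ∃! g : G, ∀ x : L, χ' x = χ (g • x)

/-- The trace form `q_L(x) = Tr_{L/K}(x²)`. -/
noncomputable def galTraceForm (K L : Type*) [Field K] [CommRing L] [Algebra K L] :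
    QuadraticForm K L :=
  (Algebra.traceForm K L).toQuadraticMap

theorem galTraceForm_apply (K L : Type*) [Field K] [CommRing L] [Algebra K L] (x : L) :
    galTraceForm K L x = Algebra.trace K L (x ^ 2) := by
  simp [galTraceForm, Algebra.traceForm_apply, sq]

/-! ### Group theory -/

/-- `S` is the (internal) direct product of its subgroups `G₁` and `G₂`. -/
def IsInternalDirectProduct {S : Type*} [Group S] (G₁ G₂ : Subgroup S) : Prop :=
  (∀ x ∈ G₁, ∀ y ∈ G₂, x * y = y * x) ∧ G₁ ⊓ G₂ = ⊥ ∧ G₁ ⊔ G₂ = ⊤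

/-- `S` is metacyclic: it has a cyclic normal subgroup with cyclic quotient. -/
def IsMetacyclic (S : Type*) [Group S] : Prop :=
  ∃ (N : Subgroup S) (_ : N.Normal), IsCyclic N ∧ IsCyclic (S ⧸ N)

/-! ### Mod 2 cohomology in degrees at most two. -/

section Cohomology

variable {Γ : Type*} [Group Γ] [TopologicalSpace Γ]

/-! A geometric point `χ : L → Ks` turns the Galois action into a homomorphism `φ` to `G`. Then `x ↦
(g ↦ χ (g • x))` sends `L` into the functions on `G` that are equivariant under left translation
through `φ`, and the trace form becomes `∑ f(g)²` (`coe_dotForm_equivariantOf`).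

Restriction to an open subgroup of odd index is injective on `H¹` and `H²`
(`contH1_eq_zero_of_res_eq_zero`, `contH2_eq_zero_of_res_eq_zero`). For a suitable `χ` the preimage
`Δ` of `S` has odd index (`exists_odd_index_comap`), so it is enough to work over the fixed field of
`Δ`. There `G`, as a set with left action of `S = G₁ × G₂`, is the product of `G₁` and `G₂ × G/S`,
and the form splits as `q₁ ⊗ q₂`.

Let `G₁` be the non-cyclic factor. Its translations are even permutations, so `q₁` has trivial
discriminant (`sum_fixedKummer_eq_zero`), and its dimension is divisible by four. Modulo degree
three, scaling `q₁` by any `b` then leaves its total class `w` unchanged (`prod_ofH1_add_eq`), so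
`w(q₁ ⊗ q₂) = w(q₁) ^ dim q₂`. This is `1`, because `dim q₂` is even, `w₁(q₁) = 0` and `H²` is
killed by two (`prod_ofH1_eq_one`).

Comparing the given diagonalisation with this one requires that `w` depend only on the form. That
follows from Witt's chain equivalence (`prod_eq_of_mem_span`), whose binary step is the Steinberg
relation (`cupH1_fixedKummer_eq_zero`). -/

theorem contH1_add_self (χ : contH1 Γ) : χ + χ = 0 := by
  ext g
  exact CharTwo.add_self_eq_zero (χ.1 g)

theorem contH2_mk_eq_zero_iff (f : contZ2 Γ) :
    (QuotientAddGroup.mk f : contH2 Γ) = 0 ↔ f.1 ∈ contB2 Γ := by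
  rw [QuotientAddGroup.eq_zero_iff, AddSubgroup.mem_addSubgroupOf]

theorem contH2_add_self (x : contH2 Γ) : x + x = 0 := by
  induction x using QuotientAddGroup.induction_on with
  | H f =>
    rw [← QuotientAddGroup.mk_add, contH2_mk_eq_zero_iff]
    have : ((f + f : contZ2 Γ) : Γ × Γ → ZMod 2) = 0 := by
      funext g
      exact CharTwo.add_self_eq_zero (f.1 g)
    rw [this]
    exact zero_mem _

theorem cupH1_add_left (χ χ' ψ : contH1 Γ) :
    cupH1 (χ + χ') ψ = cupH1 χ ψ + cupH1 χ' ψ := by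
  unfold cupH1
  rw [← QuotientAddGroup.mk_add]
  congr 1
  ext p
  exact add_mul _ _ _

theorem cupH1_add_right (χ ψ ψ' : contH1 Γ) :
    cupH1 χ (ψ + ψ') = cupH1 χ ψ + cupH1 χ ψ' := by
  unfold cupH1
  rw [← QuotientAddGroup.mk_add]
  congr 1
  ext p
  exact mul_add _ _ _

theorem cupH1_eq_zero_iff (χ ψ : contH1 Γ) : cupH1 χ ψ = 0 ↔
    ∃ c : Γ → ZMod 2, Continuous c ∧ ∀ g h, χ.1 g * ψ.1 h = c h - c (g * h) + c g :=
  contH2_mk_eq_zero_iff _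

theorem cupH1_comm (χ ψ : contH1 Γ) : cupH1 χ ψ = cupH1 ψ χ := by
  have h : cupH1 χ ψ + cupH1 ψ χ = 0 := by
    unfold cupH1
    rw [← QuotientAddGroup.mk_add, contH2_mk_eq_zero_iff]
    -- The failure of `χψ` to be additive is exactly the pair of cross terms.
    refine ⟨fun g => χ.1 g * ψ.1 g, χ.2.1.mul ψ.2.1, fun g h => ?_⟩
    change χ.1 g * ψ.1 h + ψ.1 g * χ.1 h = _
    simp only [χ.2.2, ψ.2.2]
    have h2 : (2 : ZMod 2) = 0 := rfl
    linear_combination (χ.1 g * ψ.1 h + ψ.1 g * χ.1 h) * h2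
  rw [← add_right_cancel_iff (a := cupH1 ψ χ), h, contH2_add_self]

theorem cupH1_zero_left (ψ : contH1 Γ) : cupH1 0 ψ = 0 := by
  have h := cupH1_add_left 0 0 ψ
  rwa [add_zero, left_eq_add] at h

theorem cupH1_zero_right (ψ : contH1 Γ) : cupH1 ψ 0 = 0 := by
  rw [cupH1_comm, cupH1_zero_left]

theorem cupH1_sum_right {ι : Type*} (s : Finset ι) (χ : contH1 Γ) (f : ι → contH1 Γ) :
    cupH1 χ (∑ i ∈ s, f i) = ∑ i ∈ s, cupH1 χ (f i) :=
  map_sum (AddMonoidHom.mk' (cupH1 χ) (cupH1_add_right χ)) f s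

/-- Classes `1 + x₁ + x₂` with `xᵢ ∈ Hⁱ(Γ, ℤ/2ℤ)`, multiplied as in the cohomology ring modulo
degrees at least three. -/
@[ext]
structure TruncClass (Γ : Type*) [Group Γ] [TopologicalSpace Γ] where
  one : contH1 Γ
  two : contH2 Γ

/-! ### Total classes modulo degree three. -/

namespace TruncClass

noncomputable instance : CommMonoid (TruncClass Γ) where
  mul x y := ⟨x.one + y.one, x.two + y.two + cupH1 x.one y.one⟩
  one := ⟨0, 0⟩
  mul_assoc x y z := by
    refine TruncClass.ext (add_assoc _ _ _) ?_
    change x.two + y.two + cupH1 x.one y.one + z.two + cupH1 (x.one + y.one) z.one =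
      x.two + (y.two + z.two + cupH1 y.one z.one) + cupH1 x.one (y.one + z.one)
    rw [cupH1_add_left, cupH1_add_right]
    abel
  one_mul x := by
    refine TruncClass.ext (zero_add _) ?_
    change 0 + x.two + cupH1 0 x.one = x.two
    rw [cupH1_zero_left, zero_add, add_zero]
  mul_one x := by
    refine TruncClass.ext (add_zero _) ?_
    change x.two + 0 + cupH1 x.one 0 = x.two
    rw [cupH1_zero_right, add_zero, add_zero]
  mul_comm x y := by
    refine TruncClass.ext (add_comm _ _) ?_
    change x.two + y.two + cupH1 x.one y.one = y.two + x.two + cupH1 y.one x.one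
    rw [cupH1_comm, add_comm x.two]

/-- The class `1 + χ`. -/
def ofH1 (χ : contH1 Γ) : TruncClass Γ := ⟨χ, 0⟩

@[simp] theorem ofH1_one (χ : contH1 Γ) : (ofH1 χ).one = χ := rfl

@[simp] theorem ofH1_two (χ : contH1 Γ) : (ofH1 χ).two = 0 := rfl

@[simp] theorem mul_one' (x y : TruncClass Γ) : (x * y).one = x.one + y.one := rfl

@[simp] theorem mul_two (x y : TruncClass Γ) :
    (x * y).two = x.two + y.two + cupH1 x.one y.one := rfl

@[simp] theorem one_one : (1 : TruncClass Γ).one = 0 := rfl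

@[simp] theorem one_two : (1 : TruncClass Γ).two = 0 := rfl

theorem prod_one {ι : Type*} (s : Finset ι) (f : ι → contH1 Γ) :
    (∏ i ∈ s, ofH1 (f i)).one = ∑ i ∈ s, f i := by
  classical
  induction s using Finset.induction_on with
  | empty => rfl
  | insert i s hi ih => rw [Finset.prod_insert hi, Finset.sum_insert hi, ← ih, mul_one', ofH1_one]

theorem prod_univ_two {n : ℕ} (f : Fin n → contH1 Γ) :
    (∏ i, ofH1 (f i)).two = ∑ i, ∑ j ∈ Finset.Ioi i, cupH1 (f i) (f j) := by
  induction n with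
  | zero => rfl
  | succ n ih =>
    rw [Fin.prod_univ_succ, mul_two, prod_one, ih, Fin.sum_univ_succ, Fin.sum_Ioi_zero, ofH1_two,
      ofH1_one, zero_add, add_comm, cupH1_sum_right]
    simp only [Fin.sum_Ioi_succ]

/-- Expand the second elementary symmetric function of the `f i + ψ`: each pair contributes one `ψ ∪
ψ`, and each `f i` meets `ψ` in `card - 1` pairs. The coefficient is written `card + 1`, which has
the same parity and avoids truncated subtraction. -/
theorem prod_ofH1_add {ι : Type*} (s : Finset ι) (f : ι → contH1 Γ) (ψ : contH1 Γ) :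
    ∏ i ∈ s, ofH1 (f i + ψ) = ⟨∑ i ∈ s, f i + s.card • ψ,
      (∏ i ∈ s, ofH1 (f i)).two + (s.card + 1) • cupH1 (∑ i ∈ s, f i) ψ +
        s.card.choose 2 • cupH1 ψ ψ⟩ := by
  classical
  induction s using Finset.induction_on with
  | empty =>
    simp only [Finset.prod_empty, Finset.sum_empty, Finset.card_empty, zero_smul, cupH1_zero_left,
      smul_zero, add_zero, Nat.choose_zero_succ]
    rfl
  | insert i s hi ih =>
    have hsmul : ∀ (m : ℕ) (χ : contH1 Γ), cupH1 χ (m • ψ) = m • cupH1 χ ψ := fun m χ =>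
      map_nsmul (AddMonoidHom.mk' (cupH1 χ) (cupH1_add_right _)) m ψ
    have hch : (s.card + 1).choose 2 = s.card + s.card.choose 2 := by
      rw [Nat.choose_succ_succ' s.card 1, Nat.choose_one_right]
    rw [Finset.prod_insert hi, ih, Finset.prod_insert hi, Finset.sum_insert hi,
      Finset.card_insert_of_notMem hi]
    ext1
    · simp only [mul_one', ofH1_one, add_smul, one_smul]
      abel
    · simp only [mul_two, ofH1_one, ofH1_two, prod_one, cupH1_add_right, cupH1_add_left, hsmul,
        cupH1_comm ψ (∑ i ∈ s, f i), hch,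
        smul_add, add_smul, one_smul]
      have h1 := contH2_add_self (cupH1 (f i) ψ)
      rw [← sub_eq_zero, ← neg_eq_zero, ← h1]
      module

/-- Twisting `4k` classes of degree one with vanishing sum does not change their product. -/
theorem prod_ofH1_add_eq {ι : Type*} (s : Finset ι) (f : ι → contH1 Γ) (ψ : contH1 Γ)
    (hcard : 4 ∣ s.card) (hsum : ∑ i ∈ s, f i = 0) :
    ∏ i ∈ s, ofH1 (f i + ψ) = ∏ i ∈ s, ofH1 (f i) := by
  have h2 : Even s.card := even_iff_two_dvd.2 (dvd_trans (by norm_num) hcard)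
  -- Divisibility by four, not just two, is what removes the term `ψ ∪ ψ`.
  have hc : Even (s.card.choose 2) := by
    obtain ⟨k, hk⟩ := hcard
    rw [Nat.choose_two_right, hk, show 4 * k * (4 * k - 1) = 2 * (2 * (k * (4 * k - 1))) by ring,
      Nat.mul_div_cancel_left _ two_pos]
    exact even_two_mul _
  rw [prod_ofH1_add]
  ext1
  · obtain ⟨k, hk⟩ := h2
    rw [prod_one, hsum, hk, add_smul, contH1_add_self, add_zero]
  · obtain ⟨k, hk⟩ := hc
    simp only
    rw [hsum, cupH1_zero_left, smul_zero, add_zero, hk, add_smul, contH2_add_self, add_zero]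

end TruncClass

/-! ### Restriction to subgroups of odd index. -/

/-- The restriction of `H¹` to a subgroup. -/
def contH1Res (Δ : Subgroup Γ) : contH1 Γ →+ contH1 Δ where
  toFun χ := ⟨fun g => χ.1 g, χ.2.1.comp continuous_subtype_val, fun g h => χ.2.2 g h⟩
  map_zero' := rfl
  map_add' _ _ := rfl

/-- The restriction of two-cocycles to a subgroup. -/
def contZ2Res (Δ : Subgroup Γ) : contZ2 Γ →+ contZ2 Δ where
  toFun f := ⟨fun p => f.1 (p.1, p.2),
    f.2.1.comp ((continuous_subtype_val.comp continuous_fst).prodMk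
      (continuous_subtype_val.comp continuous_snd)), fun g h j => f.2.2 g h j⟩
  map_zero' := rfl
  map_add' _ _ := rfl

/-- The restriction of `H²` to a subgroup. -/
def contH2Res (Δ : Subgroup Γ) : contH2 Γ →+ contH2 Δ :=
  QuotientAddGroup.map _ _ (contZ2Res Δ) fun f hf => by
    obtain ⟨c, hc, hcf⟩ := AddSubgroup.mem_addSubgroupOf.1 hf
    refine AddSubgroup.mem_comap.2 (AddSubgroup.mem_addSubgroupOf.2 ?_)
    exact ⟨fun g => c g, hc.comp continuous_subtype_val, fun g h => hcf g h⟩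

theorem contH2Res_cupH1 (Δ : Subgroup Γ) (χ ψ : contH1 Γ) :
    contH2Res Δ (cupH1 χ ψ) = cupH1 (contH1Res Δ χ) (contH1Res Δ ψ) := rfl

/-- The kernel of `χ` contains `Δ`, so its index divides an odd number as well as two. -/
theorem contH1_eq_zero_of_res_eq_zero {Δ : Subgroup Γ} (hodd : Odd Δ.index) {χ : contH1 Γ}
    (h : contH1Res Δ χ = 0) : χ = 0 := by
  let φ : Γ →* Multiplicative (ZMod 2) := MonoidHom.mk' (fun g => Multiplicative.ofAdd (χ.1 g))
    fun g h => by rw [χ.2.2]; rfl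
  have hle : Δ ≤ φ.ker := fun g hg =>
    congrArg Multiplicative.ofAdd (congrFun (congrArg Subtype.val h) (⟨g, hg⟩ : Δ))
  have hdvd : φ.ker.index ∣ Δ.index := Subgroup.index_dvd_of_le hle
  have h2 : φ.ker.index ∣ 2 := by
    rw [Subgroup.index_ker]
    have := Subgroup.card_subgroup_dvd_card φ.range
    rwa [Nat.card_eq_fintype_card (α := Multiplicative (ZMod 2)), Fintype.card_multiplicative,
      ZMod.card] at this
  rcases (Nat.dvd_prime Nat.prime_two).1 h2 with h1 | h1
  · ext g
    have hg : g ∈ φ.ker := by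
      rw [Subgroup.index_eq_one.1 h1]
      trivial
    exact congrArg Multiplicative.toAdd hg
  · rw [h1] at hdvd
    exact absurd (even_iff_two_dvd.2 hdvd) (Nat.not_even_iff_odd.2 hodd)

/-- A two-cocycle that becomes a coboundary on an open subgroup of odd index is a coboundary. -/
theorem mem_contB2_of_restrict [IsTopologicalGroup Γ] {Δ : Subgroup Γ}
    (hopen : IsOpen (Δ : Set Γ)) (hodd : Odd Δ.index) {f : Γ × Γ → ZMod 2} (hf : f ∈ contZ2 Γ)
    (h : (fun p : Δ × Δ => f (p.1, p.2)) ∈ contB2 Δ) : f ∈ contB2 Γ := by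
  classical
  obtain ⟨c, hc, hcf⟩ := h
  have hfin : Finite (Γ ⧸ Δ) := by
    have : Δ.FiniteIndex := ⟨fun h0 => by simp [h0] at hodd⟩
    infer_instance
  have := Fintype.ofFinite (Γ ⧸ Δ)
  let r : Γ ⧸ Δ → Γ := Quotient.out
  have hr : ∀ x, (r x : Γ ⧸ Δ) = x := fun x => Quotient.out_eq' x
  have hδ : ∀ (g : Γ) (x : Γ ⧸ Δ), (r (g • x))⁻¹ * (g * r x) ∈ Δ := fun g x => by
    rw [← QuotientGroup.eq, hr]
    change g • x = g • (r x : Γ ⧸ Δ)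
    rw [hr]
  -- Explicit transfer: `δ` measures how far the representatives `r` are from being permuted by `g`,
  -- and `ε` below carries `c` along it.
  let δ : Γ → Γ ⧸ Δ → Δ := fun g x => ⟨(r (g • x))⁻¹ * (g * r x), hδ g x⟩
  have hrδ : ∀ g x, r (g • x) * δ g x = g * r x := fun g x => mul_inv_cancel_left _ _
  have hδmul : ∀ g h x, δ (g * h) x = δ g (h • x) * δ h x := fun g h x => by
    apply Subtype.ext
    apply mul_left_cancel (a := r ((g * h) • x))
    rw [hrδ, Subgroup.coe_mul, ← mul_assoc, mul_smul, hrδ, mul_assoc g (r _), hrδ, mul_assoc]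
  let ε : Γ → Γ ⧸ Δ → ZMod 2 := fun g x => f (g, r x) - f (r (g • x), δ g x) + c (δ g x)
  have hdisc : DiscreteTopology (Γ ⧸ Δ) := QuotientGroup.discreteTopology hopen
  have hact : ∀ x : Γ ⧸ Δ, Continuous fun g : Γ => g • x := fun x => by
    have : (fun g : Γ => g • x) = fun g => ((g * r x : Γ) : Γ ⧸ Δ) := by
      funext g
      conv_lhs => rw [← hr x]
      rfl
    rw [this]
    exact continuous_quotient_mk'.comp (continuous_mul_const _)
  have hcont : ∀ x, Continuous fun g => ε g x := fun x => by
    have h1 : Continuous fun g => r (g • x) := continuous_of_discreteTopology.comp (hact x)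
    have h2 : Continuous fun g => δ g x :=
      (h1.inv.mul (continuous_mul_const _)).subtype_mk _
    exact ((hf.1.comp (continuous_id.prodMk continuous_const)).sub
      (hf.1.comp (h1.prodMk (continuous_subtype_val.comp h2)))).add (hc.comp h2)
  -- With values in functions on `Γ ⧸ Δ`, the constant cocycle `f` is the coboundary of `ε`. Summing
  -- over the cosets multiplies `f` by their number, which is `1` in `ZMod 2`.
  have key : ∀ g h x, f (g, h) = ε g (h • x) + ε h x - ε (g * h) x := fun g h x => by
    have e1 := hf.2 g h (r x)
    have e2 := hf.2 g (r (h • x)) (δ h x)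
    have e3 := hf.2 (r (g • h • x)) (δ g (h • x)) (δ h x)
    have e4 := hcf (δ g (h • x)) (δ h x)
    rw [hrδ] at e2 e3
    simp only [ε, hδmul, mul_smul]
    rw [Subgroup.coe_mul]
    simp only at e4
    linear_combination -e1 + e2 - e3 + e4
  refine ⟨fun g => ∑ x, ε g x, continuous_finsetSum _ fun x _ => hcont x, fun g h => ?_⟩
  have hcard : ((Fintype.card (Γ ⧸ Δ) : ℕ) : ZMod 2) = 1 := by
    rw [← Nat.card_eq_fintype_card]
    exact (ZMod.natCast_eq_one_iff_odd).2 hodd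
  have hsum : ∑ x : Γ ⧸ Δ, ε g (h • x) = ∑ x, ε g x :=
    Fintype.sum_equiv (MulAction.toPerm h) _ _ fun x => rfl
  calc f (g, h) = ∑ x : Γ ⧸ Δ, f (g, h) := by
        rw [Finset.sum_const, Finset.card_univ, nsmul_eq_mul, hcard, one_mul]
    _ = ∑ x, (ε g (h • x) + ε h x - ε (g * h) x) := Finset.sum_congr rfl fun x _ => key g h x
    _ = _ := by
        rw [Finset.sum_sub_distrib, Finset.sum_add_distrib, hsum]
        ring

theorem contH2_eq_zero_of_res_eq_zero [IsTopologicalGroup Γ] {Δ : Subgroup Γ}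
    (hopen : IsOpen (Δ : Set Γ)) (hodd : Odd Δ.index) {x : contH2 Γ} (h : contH2Res Δ x = 0) :
    x = 0 := by
  induction x using QuotientAddGroup.induction_on with
  | H f =>
    rw [contH2_mk_eq_zero_iff]
    exact mem_contB2_of_restrict hopen hodd f.2 ((contH2_mk_eq_zero_iff (contZ2Res Δ f)).1 h)

end Cohomology

/-! ### Kummer classes over fixed fields and the Steinberg relation. -/

section Kummer

/-- The sign `1` or `-1` attached to an element of `ℤ/2ℤ`. -/
def zsign (E : Type*) [Field E] (z : ZMod 2) : E := if z = 0 then 1 else -1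

section zsign

variable {E : Type*} [Field E]

@[simp] theorem zsign_zero : zsign E 0 = 1 := if_pos rfl

@[simp] theorem zsign_one : zsign E 1 = -1 := if_neg one_ne_zero

theorem zmod_two_cases (z : ZMod 2) : z = 0 ∨ z = 1 := by
  revert z
  decide

theorem zsign_add (y z : ZMod 2) : zsign E (y + z) = zsign E y * zsign E z := by
  have h11 : (1 + 1 : ZMod 2) = 0 := rfl
  rcases zmod_two_cases y with rfl | rfl <;> rcases zmod_two_cases z with rfl | rfl <;>
    simp [h11]

theorem zsign_injective (h2 : (2 : E) ≠ 0) : Function.Injective (zsign E) := fun y z h => by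
  have h1 : (1 : E) ≠ -1 := fun h => h2 (by linear_combination h)
  rcases zmod_two_cases y with rfl | rfl <;> rcases zmod_two_cases z with rfl | rfl
  · rfl
  · exact absurd (by simpa using h) h1
  · exact absurd (by simpa using h.symm) h1
  · rfl

theorem zsign_sq (z : ZMod 2) : zsign E z ^ 2 = 1 := by
  rcases zmod_two_cases z with rfl | rfl <;> simp

theorem smul_zsign {Γ : Type*} [Group Γ] [MulSemiringAction Γ E] (σ : Γ) (z : ZMod 2) :
    σ • zsign E z = zsign E z := by
  rcases zmod_two_cases z with rfl | rfl <;> simp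

end zsign

/-- A topological group acts with open stabilizers on a field of characteristic not two in which
every element is a square. -/
class IsDiscreteQuadClosed (Γ E : Type*) [Group Γ] [TopologicalSpace Γ] [Field E]
    [MulSemiringAction Γ E] : Prop where
  isOpen_stabilizer : ∀ x : E, IsOpen (MulAction.stabilizer Γ x : Set Γ)
  exists_sq : ∀ x : E, ∃ s, s ^ 2 = x
  two_ne_zero : (2 : E) ≠ 0

section Group

variable {Γ E : Type*} [Group Γ] [Field E] [MulSemiringAction Γ E]

open Classical in
/-- The sign by which `σ` acts on the square roots of `a`. -/
noncomputable def sqrtSign (a : E) (σ : Γ) : ZMod 2 :=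
  if ∀ s : E, s ^ 2 = a → σ • s = s then 0 else 1

theorem smul_sqrt {a s : E} (hs : s ^ 2 = a) {σ : Γ} (hσ : σ • a = a) :
    σ • s = zsign E (sqrtSign a σ) * s := by
  unfold sqrtSign
  split_ifs with h
  · simpa using h s hs
  · rcases sq_eq_sq_iff_eq_or_eq_neg.1
      (show (σ • s) ^ 2 = s ^ 2 by rw [← smul_pow', hs, hσ]) with h1 | h1
    · refine absurd (fun t ht => ?_) h
      rcases sq_eq_sq_iff_eq_or_eq_neg.1 (ht.trans hs.symm) with rfl | rfl
      · exact h1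
      · rw [smul_neg, h1]
    · simpa using h1

end Group

variable {Γ E : Type*} [Group Γ] [TopologicalSpace Γ] [Field E] [MulSemiringAction Γ E]

instance IsDiscreteQuadClosed.subgroup [IsDiscreteQuadClosed Γ E] (Δ : Subgroup Γ) :
    IsDiscreteQuadClosed Δ E where
  isOpen_stabilizer x :=
    (IsDiscreteQuadClosed.isOpen_stabilizer (Γ := Γ) x).preimage continuous_subtype_val
  exists_sq := IsDiscreteQuadClosed.exists_sq Γ
  two_ne_zero := IsDiscreteQuadClosed.two_ne_zero Γ

/-- Such an `f` is constant on the left cosets of the stabilizer of `x`, which is open. -/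
theorem IsDiscreteQuadClosed.continuous [IsTopologicalGroup Γ] [IsDiscreteQuadClosed Γ E]
    {A : Type*} [TopologicalSpace A] {f : Γ → A} (x : E)
    (h : ∀ σ τ : Γ, σ • x = τ • x → f σ = f τ) : Continuous f := by
  refine IsLocallyConstant.continuous ((IsLocallyConstant.iff_exists_open _).2 fun g => ?_)
  refine ⟨(fun y => g⁻¹ * y) ⁻¹' (MulAction.stabilizer Γ x : Set Γ),
    (IsDiscreteQuadClosed.isOpen_stabilizer x).preimage (continuous_const_mul _),
    by simp, fun y hy => h _ _ ?_⟩
  have : (g⁻¹ * y) • x = x := hy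
  rwa [mul_smul, inv_smul_eq_iff] at this

variable [IsDiscreteQuadClosed Γ E]

theorem sqrtSign_eq {a s : E} (ha : a ≠ 0) (hs : s ^ 2 = a) {σ : Γ} (hσ : σ • a = a) {z : ZMod 2}
    (hz : σ • s = zsign E z * s) : sqrtSign a σ = z := by
  have hs0 : s ≠ 0 := by
    rintro rfl
    exact ha (by rw [← hs]; simp)
  apply zsign_injective (IsDiscreteQuadClosed.two_ne_zero Γ : (2 : E) ≠ 0)
  exact mul_right_cancel₀ hs0 ((smul_sqrt hs hσ).symm.trans hz)

variable [IsTopologicalGroup Γ]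

/-- The class in `H¹` of a nonzero element of the fixed field. -/
noncomputable def fixedKummer (a : (FixedPoints.subfield Γ E)ˣ) : contH1 Γ :=
  ⟨sqrtSign (a : E), by
    obtain ⟨s, hs⟩ := IsDiscreteQuadClosed.exists_sq Γ (a : E)
    have ha : (a : E) ≠ 0 := by simp
    have hfix : ∀ σ : Γ, σ • (a : E) = a := fun σ => a.1.2 σ
    refine ⟨IsDiscreteQuadClosed.continuous s fun σ τ h =>
      sqrtSign_eq ha hs (hfix σ) (h.trans (smul_sqrt hs (hfix τ))), fun σ τ =>
      sqrtSign_eq ha hs (hfix _) ?_⟩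
    rw [mul_smul, smul_sqrt hs (hfix τ), smul_mul', smul_zsign, smul_sqrt hs (hfix σ), zsign_add]
    ring⟩

theorem smul_sqrt_fixedKummer (a : (FixedPoints.subfield Γ E)ˣ) {s : E} (hs : s ^ 2 = a) (σ : Γ) :
    σ • s = zsign E ((fixedKummer a).1 σ) * s :=
  smul_sqrt hs (a.1.2 σ)

theorem fixedKummer_apply_eq (a : (FixedPoints.subfield Γ E)ˣ) {s : E} (hs : s ^ 2 = a) {σ : Γ}
    {z : ZMod 2} (h : σ • s = zsign E z * s) : (fixedKummer a).1 σ = z :=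
  sqrtSign_eq (by simp) hs (a.1.2 σ) h

theorem fixedKummer_mul (a b : (FixedPoints.subfield Γ E)ˣ) :
    fixedKummer (a * b) = fixedKummer a + fixedKummer b := by
  obtain ⟨s, hs⟩ := IsDiscreteQuadClosed.exists_sq Γ (a : E)
  obtain ⟨t, ht⟩ := IsDiscreteQuadClosed.exists_sq Γ (b : E)
  ext σ
  refine fixedKummer_apply_eq _ (s := s * t) (by rw [mul_pow, hs, ht]; rfl) ?_
  rw [smul_mul', smul_sqrt_fixedKummer a hs, smul_sqrt_fixedKummer b ht]
  change _ = zsign E ((fixedKummer a).1 σ + (fixedKummer b).1 σ) * _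
  rw [zsign_add]
  ring

theorem fixedKummer_eq_zero (a : (FixedPoints.subfield Γ E)ˣ) {s : E} (hs : s ^ 2 = a)
    (h : ∀ σ : Γ, σ • s = s) : fixedKummer a = 0 := by
  ext σ
  refine fixedKummer_apply_eq a hs ?_
  change _ = zsign E 0 * s
  rw [zsign_zero, one_mul, h]

theorem fixedKummer_sq (a : (FixedPoints.subfield Γ E)ˣ) : fixedKummer (a ^ 2) = 0 := by
  rw [sq, fixedKummer_mul, contH1_add_self]

theorem fixedKummer_inv (a : (FixedPoints.subfield Γ E)ˣ) : fixedKummer a⁻¹ = fixedKummer a := by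
  have h := fixedKummer_mul (a ^ 2) a⁻¹
  rw [fixedKummer_sq, zero_add, sq, mul_inv_cancel_right] at h
  exact h.symm

theorem fixedKummer_prod {ι : Type*} (s : Finset ι) (a : ι → (FixedPoints.subfield Γ E)ˣ) :
    fixedKummer (∏ i ∈ s, a i) = ∑ i ∈ s, fixedKummer (a i) := by
  classical
  induction s using Finset.induction_on with
  | empty => simpa using fixedKummer_sq (1 : (FixedPoints.subfield Γ E)ˣ)
  | insert i s hi ih => rw [Finset.prod_insert hi, fixedKummer_mul, ih, Finset.sum_insert hi]

/-- The Steinberg relation in `H²`. -/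
theorem cupH1_fixedKummer_eq_zero (a b : (FixedPoints.subfield Γ E)ˣ)
    (hab : (a : FixedPoints.subfield Γ E) + b = 1) :
    cupH1 (fixedKummer a) (fixedKummer b) = 0 := by
  classical
  have h2 : (2 : E) ≠ 0 := IsDiscreteQuadClosed.two_ne_zero Γ
  have habE : (a : E) + (b : E) = 1 := congrArg Subtype.val hab
  have ha0 : (a : E) ≠ 0 := by simp
  have hb0 : (b : E) ≠ 0 := by simp
  obtain ⟨α, hα⟩ := IsDiscreteQuadClosed.exists_sq Γ (a : E)
  -- Since `b = (1 + α)(1 - α)`, the product `γγ'` is a square root of `b`. Up to sign, `Γ` permutes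
  -- `γ` and `γ'` through `χ`; the sign `c` of the action on `γ` is the cochain that bounds `ψ ∪ χ`.
  obtain ⟨γ, hγ⟩ := IsDiscreteQuadClosed.exists_sq Γ (1 + α)
  obtain ⟨γ', hγ'⟩ := IsDiscreteQuadClosed.exists_sq Γ (1 - α)
  have hβ : (γ * γ') ^ 2 = b := by
    rw [mul_pow, hγ, hγ']
    linear_combination -habE - hα
  have hα0 : α ≠ 0 := by
    rintro rfl
    exact ha0 (by rw [← hα]; simp)
  have hγγ' : γ * γ' ≠ 0 := fun h => hb0 (by rw [← hβ, h]; simp)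
  have hγ0 : γ ≠ 0 := left_ne_zero_of_mul hγγ'
  have hγ'0 : γ' ≠ 0 := right_ne_zero_of_mul hγγ'
  have hsq : γ ^ 2 ≠ γ' ^ 2 := fun h => mul_ne_zero h2 hα0 (by
    linear_combination h - hγ + hγ')
  let Y : ZMod 2 → E := fun z => if z = 0 then γ else γ'
  have hY0 : ∀ z, Y z ≠ 0 := fun z => by
    rcases zmod_two_cases z with rfl | rfl
    · exact hγ0
    · exact hγ'0
  have hYmul : ∀ z, Y z * Y (z + 1) = γ * γ' := fun z => by
    rcases zmod_two_cases z with rfl | rfl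
    · rfl
    · exact mul_comm _ _
  have hYsq : ∀ z, Y z ^ 2 = 1 + zsign E z * α := fun z => by
    rcases zmod_two_cases z with rfl | rfl
    · rw [zsign_zero, one_mul]
      exact hγ
    · rw [zsign_one, neg_one_mul, ← sub_eq_add_neg]
      exact hγ'
  set χ := fixedKummer a
  set ψ := fixedKummer b
  let c : Γ → ZMod 2 := fun σ => if σ • γ = γ ∨ σ • γ = γ' then 0 else 1
  have hc : ∀ σ, σ • γ = zsign E (c σ) * Y (χ.1 σ) := fun σ => by
    have h1 : (σ • γ) ^ 2 = Y (χ.1 σ) ^ 2 := by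
      rw [← smul_pow', hγ, hYsq, smul_add, smul_one, smul_sqrt_fixedKummer a hα]
    rcases sq_eq_sq_iff_eq_or_eq_neg.1 h1 with h | h
    · have : c σ = 0 := by
        refine if_pos ?_
        rcases zmod_two_cases (χ.1 σ) with h3 | h3
        · rw [h, h3]
          exact Or.inl rfl
        · rw [h, h3]
          exact Or.inr rfl
      rw [this, zsign_zero, one_mul, h]
    · have hne : ∀ x : E, x ≠ 0 → -x ≠ x := fun x hx hx' => mul_ne_zero h2 hx (by
        linear_combination -hx')
      have : c σ = 1 := by
        refine if_neg ?_
        rcases zmod_two_cases (χ.1 σ) with h3 | h3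
        · rw [h, h3]
          rintro (h4 | h4)
          · exact hne γ hγ0 h4
          · exact hsq (by rw [← h4]; exact (neg_sq γ).symm)
        · rw [h, h3]
          rintro (h4 | h4)
          · exact hsq (by rw [← h4]; exact neg_sq γ')
          · exact hne γ' hγ'0 h4
      rw [this, zsign_one, neg_one_mul, h]
  have hc' : ∀ σ, σ • γ' = zsign E (c σ + ψ.1 σ) * Y (χ.1 σ + 1) := fun σ => by
    have h1 := smul_sqrt_fixedKummer b hβ σ
    rw [smul_mul', hc] at h1
    have h3 := zsign_sq (E := E) (c σ)
    apply mul_left_cancel₀ (hY0 (χ.1 σ))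
    rw [zsign_add]
    have h4 := hYmul (χ.1 σ)
    linear_combination zsign E (c σ) * h1 - (Y (χ.1 σ) * σ • γ') * h3 -
      (zsign E (c σ) * zsign E (ψ.1 σ)) * h4
  have hgY : ∀ (σ : Γ) (z : ZMod 2),
      σ • Y z = zsign E (c σ + ψ.1 σ * z) * Y (χ.1 σ + z) := fun σ z => by
    rcases zmod_two_cases z with rfl | rfl
    · rw [mul_zero, add_zero, add_zero]
      exact hc σ
    · rw [mul_one]
      exact hc' σ
  rw [cupH1_comm, cupH1_eq_zero_iff]
  refine ⟨c, IsDiscreteQuadClosed.continuous γ fun σ τ h => by simp only [c, h], fun g h => ?_⟩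
  have h1 : zsign E (c (g * h)) = zsign E (c h + c g + ψ.1 g * χ.1 h) := by
    apply mul_right_cancel₀ (hY0 (χ.1 (g * h)))
    rw [← hc, mul_smul, hc, smul_mul', smul_zsign, hgY, χ.2.2, add_assoc, zsign_add (c h),
      mul_assoc]
  have h3 : (2 : ZMod 2) = 0 := rfl
  rw [zsign_injective h2 h1]
  linear_combination (ψ.1 g * χ.1 h) * h3

theorem fixedKummer_mul_sq (a x : (FixedPoints.subfield Γ E)ˣ) :
    fixedKummer (a * x ^ 2) = fixedKummer a := by
  rw [fixedKummer_mul, fixedKummer_sq, add_zero]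

/-- This is invariance under the isometry `⟨a, b⟩ ≃ ⟨c, abc⟩`. The Steinberg relation for `a/c + b/c
= 1` gives `((a) + (c)) ∪ ((b) + (c)) = 0`, which expands to the equality in degree two. -/
theorem ofH1_fixedKummer_pair (a b c : (FixedPoints.subfield Γ E)ˣ)
    (h : (a : FixedPoints.subfield Γ E) + b = c) :
    TruncClass.ofH1 (fixedKummer a) * TruncClass.ofH1 (fixedKummer b) =
      TruncClass.ofH1 (fixedKummer c) * TruncClass.ofH1 (fixedKummer (a * b * c)) := by
  have h1 := cupH1_fixedKummer_eq_zero (a * c⁻¹) (b * c⁻¹) (by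
    rw [Units.val_mul, Units.val_mul, ← add_mul, h, Units.mul_inv])
  simp only [fixedKummer_mul, fixedKummer_inv] at h1
  ext1
  · simp only [TruncClass.mul_one', TruncClass.ofH1_one, fixedKummer_mul]
    rw [add_left_comm, contH1_add_self, add_zero]
  · simp only [TruncClass.mul_two, TruncClass.ofH1_one, TruncClass.ofH1_two, fixedKummer_mul,
      zero_add]
    simp only [cupH1_add_left, cupH1_add_right] at h1 ⊢
    rw [cupH1_comm (fixedKummer a) (fixedKummer c), cupH1_comm _ (fixedKummer b)] at h1
    have h2 := contH2_add_self (cupH1 (fixedKummer a) (fixedKummer b))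
    rw [cupH1_comm (fixedKummer a) (fixedKummer b)] at h2 ⊢
    rw [← add_right_cancel_iff (a := cupH1 (fixedKummer b) (fixedKummer a)), h2, ← h1]
    abel

end Kummer

/-! ### Witt's chain equivalence for orthogonal families. -/

section ChainEquivalence

variable {F V : Type*} [Field F] [AddCommGroup V] [Module F V]

/-- The vectors `v i` are pairwise orthogonal, and `q i` is the value of `B` on the `i`-th one. -/
structure IsOrthoFamily {ι : Type*} (B : LinearMap.BilinForm F V) (v : ι → V) (q : ι → Fˣ) :
    Prop where
  ortho : ∀ i j : ι, i ≠ j → B (v i) (v j) = 0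
  norm : ∀ i, B (v i) (v i) = q i

namespace IsOrthoFamily

variable {B : LinearMap.BilinForm F V} {ι : Type*} {v : ι → V} {q : ι → Fˣ}

theorem comp_injective (h : IsOrthoFamily B v q) {κ : Type*} {e : κ → ι}
    (he : Function.Injective e) : IsOrthoFamily B (v ∘ e) (q ∘ e) :=
  ⟨fun _ _ hij => h.ortho _ _ (he.ne hij), fun _ => h.norm _⟩

theorem sum_left [Fintype ι] (h : IsOrthoFamily B v q) (x : ι → F) (j : ι) :
    B (∑ i, x i • v i) (v j) = x j * q j := by
  rw [map_sum, LinearMap.sum_apply, Finset.sum_eq_single j]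
  · rw [map_smul, LinearMap.smul_apply, h.norm, smul_eq_mul]
  · intro i _ hij
    rw [map_smul, LinearMap.smul_apply, h.ortho i j hij, smul_zero]
  · exact fun hj => absurd (Finset.mem_univ j) hj

theorem sum_self [Fintype ι] (h : IsOrthoFamily B v q) (x : ι → F) :
    B (∑ i, x i • v i) (∑ i, x i • v i) = ∑ i, x i ^ 2 * q i := by
  rw [map_sum (B (∑ i, x i • v i))]
  refine Finset.sum_congr rfl fun j _ => ?_
  rw [map_smul, h.sum_left, smul_eq_mul]
  ring

variable {M : Type*} [CommMonoid M] {w : Fˣ → M}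

theorem exists_scale [Fintype ι] (hsq : ∀ a x : Fˣ, w (a * x ^ 2) = w a)
    (h : IsOrthoFamily B v q) (i : ι) (x : Fˣ) :
    ∃ (v' : ι → V) (q' : ι → Fˣ), IsOrthoFamily B v' q' ∧
      (∀ j, v j ∈ Submodule.span F (Set.range v')) ∧ ∏ j, w (q' j) = ∏ j, w (q j) ∧
      v' i = (x : F) • v i := by
  classical
  let y : ι → Fˣ := fun j => if j = i then x else 1
  refine ⟨fun j => (y j : F) • v j, fun j => q j * y j ^ 2, ⟨fun j k hjk => ?_, fun j => ?_⟩,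
    fun j => ?_, ?_, ?_⟩
  · rw [map_smul, map_smul, LinearMap.smul_apply, h.ortho j k hjk, smul_zero, smul_zero]
  · rw [map_smul, map_smul, LinearMap.smul_apply, h.norm, smul_eq_mul, smul_eq_mul]
    push_cast
    ring
  · have : v j = ((y j)⁻¹ : F) • ((y j : F) • v j) := by
      rw [smul_smul, inv_mul_cancel₀ (y j).ne_zero, one_smul]
    rw [this]
    exact Submodule.smul_mem _ _ (Submodule.subset_span ⟨j, rfl⟩)
  · simp only [hsq]
  · simp [y]

/-- The basic move of a chain: inside the plane of `v i` and `v j`, pass to `x v i + y v j`, of norm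
`e`, and the vector `b` orthogonal to it, of norm `q i * q j * e`. After absorbing the squares `x²`
and `y²`, `hpair` compares the two pairs. -/
theorem exists_rotate [Fintype ι] [DecidableEq ι] (hB : ∀ x y, B x y = B y x)
    (hsq : ∀ a x, w (a * x ^ 2) = w a)
    (hpair : ∀ a b c : Fˣ, (a : F) + b = c → w a * w b = w c * w (a * b * c))
    (h : IsOrthoFamily B v q) {i j : ι} (hij : i ≠ j) (x y e : Fˣ)
    (he : (x ^ 2 * q i + y ^ 2 * q j : F) = e) :
    ∃ (v' : ι → V) (q' : ι → Fˣ), IsOrthoFamily B v' q' ∧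
      (∀ j, v j ∈ Submodule.span F (Set.range v')) ∧ ∏ j, w (q' j) = ∏ j, w (q j) ∧
      v' i = (x : F) • v i + (y : F) • v j ∧ ∀ k, k ≠ i → k ≠ j → v' k = v k := by
  let a : V := (x : F) • v i + (y : F) • v j
  let b : V := (y * q j : F) • v i - (x * q i : F) • v j
  let v' : ι → V := Function.update (Function.update v i a) j b
  let q' : ι → Fˣ := Function.update (Function.update q i e) j (q i * q j * e)
  have hvj : v' j = b := Function.update_self _ _ _
  have hvi : v' i = a := (Function.update_of_ne hij _ _).trans (Function.update_self _ _ _)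
  have hvk : ∀ k, k ≠ i → k ≠ j → v' k = v k := fun k hi hj =>
    (Function.update_of_ne hj _ _).trans (Function.update_of_ne hi _ _)
  have hqj : q' j = q i * q j * e := Function.update_self _ _ _
  have hqi : q' i = e := (Function.update_of_ne hij _ _).trans (Function.update_self _ _ _)
  have hqk : ∀ k, k ≠ i → k ≠ j → q' k = q k := fun k hi hj =>
    (Function.update_of_ne hj _ _).trans (Function.update_of_ne hi _ _)
  have hij0 := h.ortho i j hij
  have hji0 := h.ortho j i hij.symm
  have hii := h.norm i
  have hjj := h.norm j
  have haa : B a a = e := by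
    simp only [a, map_add, map_smul, LinearMap.add_apply, LinearMap.smul_apply, smul_eq_mul, hii,
      hjj, hij0, hji0]
    linear_combination he
  have hbb : B b b = (q i * q j * e : F) := by
    simp only [b, map_sub, map_smul, LinearMap.sub_apply, LinearMap.smul_apply, smul_eq_mul, hii,
      hjj, hij0, hji0]
    linear_combination (q i * q j : F) * he
  have hab : B a b = 0 := by
    simp only [a, b, map_add, map_sub, map_smul, LinearMap.add_apply, LinearMap.smul_apply,
      smul_eq_mul, hii, hjj, hij0, hji0]
    ring
  have hak : ∀ k, k ≠ i → k ≠ j → B a (v k) = 0 := fun k hi hj => by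
    simp only [a, map_add, map_smul, LinearMap.add_apply, LinearMap.smul_apply,
      h.ortho i k hi.symm, h.ortho j k hj.symm, smul_zero, add_zero]
  have hbk : ∀ k, k ≠ i → k ≠ j → B b (v k) = 0 := fun k hi hj => by
    simp only [b, map_sub, map_smul, LinearMap.sub_apply, LinearMap.smul_apply,
      h.ortho i k hi.symm, h.ortho j k hj.symm, smul_zero, sub_zero]
  have ha_mem : a ∈ Submodule.span F (Set.range v') := Submodule.subset_span ⟨i, hvi⟩
  have hb_mem : b ∈ Submodule.span F (Set.range v') := Submodule.subset_span ⟨j, hvj⟩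
  refine ⟨v', q', ⟨fun k l hkl => ?_, fun k => ?_⟩, fun k => ?_, ?_, hvi, hvk⟩
  · by_cases hki : k = i
    · subst hki
      rw [hvi]
      by_cases hlj : l = j
      · rw [hlj, hvj, hab]
      · rw [hvk l hkl.symm hlj, hak l hkl.symm hlj]
    by_cases hkj : k = j
    · subst hkj
      rw [hvj]
      by_cases hli : l = i
      · rw [hli, hvi, hB, hab]
      · rw [hvk l hli hkl.symm, hbk l hli hkl.symm]
    rw [hvk k hki hkj]
    by_cases hli : l = i
    · rw [hli, hvi, hB, hak k hki hkj]
    by_cases hlj : l = j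
    · rw [hlj, hvj, hB, hbk k hki hkj]
    · rw [hvk l hli hlj, h.ortho k l hkl]
  · by_cases hki : k = i
    · rw [hki, hvi, hqi, haa]
    by_cases hkj : k = j
    · rw [hkj, hvj, hqj, hbb]
      push_cast
      rfl
    · rw [hvk k hki hkj, hqk k hki hkj, h.norm]
  · by_cases hki : k = i
    · have : v k = (e⁻¹ : F) • ((x * q i : F) • a + (y : F) • b) := by
        rw [hki, eq_inv_smul_iff₀ e.ne_zero, ← he]
        simp only [a, b]
        module
      rw [this]
      exact Submodule.smul_mem _ _ (add_mem (Submodule.smul_mem _ _ ha_mem)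
        (Submodule.smul_mem _ _ hb_mem))
    by_cases hkj : k = j
    · have : v k = (e⁻¹ : F) • ((y * q j : F) • a - (x : F) • b) := by
        rw [hkj, eq_inv_smul_iff₀ e.ne_zero, ← he]
        simp only [a, b]
        module
      rw [this]
      exact Submodule.smul_mem _ _ (sub_mem (Submodule.smul_mem _ _ ha_mem)
        (Submodule.smul_mem _ _ hb_mem))
    · exact Submodule.subset_span ⟨k, hvk k hki hkj⟩
  · have hsplit : ∀ r : ι → Fˣ, ∏ k, w (r k) =
        w (r i) * w (r j) * ∏ k ∈ (Finset.univ.erase i).erase j, w (r k) := fun r => by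
      rw [mul_assoc, Finset.mul_prod_erase _ (fun k => w (r k))
        (Finset.mem_erase.2 ⟨hij.symm, Finset.mem_univ _⟩),
        Finset.mul_prod_erase _ (fun k => w (r k)) (Finset.mem_univ i)]
    have hw : w (q i) * w (q j) = w e * w (q i * q j * e) := by
      rw [← hsq (q i) x, ← hsq (q j) y, hpair (q i * x ^ 2) (q j * y ^ 2) e (by
        rw [← he]
        push_cast
        ring), ← hsq (q i * q j * e) (x * y)]
      congr 2
      rw [mul_pow]
      ac_rfl
    rw [hsplit q', hsplit q, hqi, hqj, hw]
    congr 1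
    refine Finset.prod_congr rfl fun k hk => ?_
    rw [Finset.mem_erase, Finset.mem_erase] at hk
    rw [hqk k hk.2.1 hk.1]

/-- An anisotropic vector in the span of an orthogonal family is a member of another orthogonal
family with the same span and the same invariant. -/
theorem exists_contains [Fintype ι] (h2 : (2 : F) ≠ 0) (hB : ∀ x y, B x y = B y x)
    (hsq : ∀ a x, w (a * x ^ 2) = w a)
    (hpair : ∀ a b c : Fˣ, (a : F) + b = c → w a * w b = w c * w (a * b * c))
    (m : ℕ) : ∀ (v : ι → V) (q : ι → Fˣ) (_ : IsOrthoFamily B v q) (x : ι → F)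
    (_ : {i | x i ≠ 0}.ncard ≤ m) (_ : B (∑ i, x i • v i) (∑ i, x i • v i) ≠ 0),
    ∃ (v' : ι → V) (q' : ι → Fˣ), IsOrthoFamily B v' q' ∧
      (∀ j, v j ∈ Submodule.span F (Set.range v')) ∧ ∏ j, w (q' j) = ∏ j, w (q j) ∧
      ∃ i, v' i = ∑ i, x i • v i := by
  classical
  induction m with
  | zero =>
    intro v q h x hx hne
    have hx0 : {i | x i ≠ 0} = ∅ := (Set.ncard_eq_zero (Set.toFinite _)).1 (Nat.le_zero.1 hx)
    have : ∀ i, x i = 0 := fun i => by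
      by_contra hi
      have : i ∈ {i | x i ≠ 0} := hi
      rw [hx0] at this
      exact this
    exact absurd (by simp [this]) hne
  | succ m ih =>
    intro v q h x hx hne
    -- Two terms of the sum with nonzero joint norm can be rotated into a single basis vector, which
    -- shortens the support.
    by_cases hrot : ∃ i j, i ≠ j ∧ x i ≠ 0 ∧ x j ≠ 0 ∧ x i ^ 2 * q i + x j ^ 2 * q j ≠ 0
    · obtain ⟨i, j, hij, hi, hj, he⟩ := hrot
      obtain ⟨v', q', h', hspan, hw, hvi, hvk⟩ := h.exists_rotate hB hsq hpair hij
        (Units.mk0 _ hi) (Units.mk0 _ hj) (Units.mk0 _ he) rfl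
      let x' : ι → F := Function.update (Function.update x i 1) j 0
      have hx'j : x' j = 0 := Function.update_self _ _ _
      have hx'i : x' i = 1 := (Function.update_of_ne hij _ _).trans (Function.update_self _ _ _)
      have hx'k : ∀ k, k ≠ i → k ≠ j → x' k = x k := fun k hi hj =>
    (Function.update_of_ne hj _ _).trans (Function.update_of_ne hi _ _)
      have hsplit : ∀ r : ι → V, ∑ k, r k =
          r i + r j + ∑ k ∈ (Finset.univ.erase i).erase j, r k := fun r => by
        rw [add_assoc,
          Finset.add_sum_erase _ r (Finset.mem_erase.2 ⟨hij.symm, Finset.mem_univ _⟩),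
          Finset.add_sum_erase _ r (Finset.mem_univ i)]
      have hsum : ∑ k, x' k • v' k = ∑ k, x k • v k := by
        rw [hsplit, hsplit fun k => x k • v k, hx'j, hx'i, one_smul, zero_smul, add_zero, hvi]
        congr 1
        refine Finset.sum_congr rfl fun k hk => ?_
        rw [Finset.mem_erase, Finset.mem_erase] at hk
        rw [hx'k k hk.2.1 hk.1, hvk k hk.2.1 hk.1]
      have hlt : {i | x' i ≠ 0}.ncard < {i | x i ≠ 0}.ncard := by
        refine Set.ncard_lt_ncard ⟨fun k hk => ?_, fun hsub => ?_⟩ (Set.toFinite _)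
        · change x' k ≠ 0 at hk
          by_cases hki : k = i
          · rw [hki]
            exact hi
          · by_cases hkj : k = j
            · rw [hkj]
              exact hj
            · rw [hx'k k hki hkj] at hk
              exact hk
        · exact hsub (show j ∈ {i | x i ≠ 0} from hj) hx'j
      obtain ⟨v'', q'', h'', hspan', hw', i', hi'⟩ := ih v' q' h' x' (by omega)
        (by rw [hsum]; exact hne)
      refine ⟨v'', q'', h'', fun k => ?_, hw'.trans hw, i', hi'.trans hsum⟩
      refine Submodule.span_le.2 ?_ (hspan k)
      rintro _ ⟨l, rfl⟩
      exact hspan' l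
    · push Not at hrot
      rw [h.sum_self] at hne
      obtain ⟨i, hi⟩ : ∃ i, x i ≠ 0 := by
        by_contra! hall
        exact hne (by simp [hall])
      -- Now any two terms have opposite norms. Three terms would force `2 * x i ^ 2 * q i = 0`, and
      -- exactly two would make the whole vector isotropic.
      have honly : ∀ j, j ≠ i → x j = 0 := fun j hji => by
        by_contra hj
        have hy := hrot i j hji.symm hi hj
        have hthird : ∀ k, k ≠ i → k ≠ j → x k = 0 := fun k hki hkj => by
          by_contra hk
          have h1 := hrot i k hki.symm hi hk
          have h3 := hrot j k hkj.symm hj hk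
          refine mul_ne_zero h2 (mul_ne_zero (pow_ne_zero 2 hi) (q i).ne_zero) ?_
          linear_combination hy + h1 - h3
        refine hne ?_
        rw [← Finset.sum_subset (Finset.subset_univ {i, j}) fun k _ hk => ?_,
          Finset.sum_pair hji.symm, hy]
        simp only [Finset.mem_insert, Finset.mem_singleton, not_or] at hk
        simp [hthird k hk.1 hk.2]
      obtain ⟨v', q', h', hspan, hw, hvi⟩ := h.exists_scale hsq i (Units.mk0 _ hi)
      refine ⟨v', q', h', hspan, hw, i, ?_⟩
      rw [hvi, Finset.sum_eq_single i]
      · rfl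
      · intro j _ hji
        rw [honly j hji, zero_smul]
      · exact fun hi => absurd (Finset.mem_univ i) hi

/-- Invariance under change of orthogonal basis, by Witt's chain equivalence. -/
theorem prod_eq_of_mem_span (h2 : (2 : F) ≠ 0) (hB : ∀ x y, B x y = B y x)
    (hsq : ∀ a x, w (a * x ^ 2) = w a)
    (hpair : ∀ a b c : Fˣ, (a : F) + b = c → w a * w b = w c * w (a * b * c)) {n : ℕ} :
    ∀ {u v : Fin n → V} {p q : Fin n → Fˣ} (_ : IsOrthoFamily B u p) (_ : IsOrthoFamily B v q)
    (_ : ∀ i, u i ∈ Submodule.span F (Set.range v)), ∏ i, w (p i) = ∏ i, w (q i) := by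
  induction n with
  | zero =>
    intros
    simp
  | succ n ih =>
    intro u v p q hu hv huv
    obtain ⟨x, hx⟩ := (Submodule.mem_span_range_iff_exists_fun F).1 (huv 0)
    -- Change `v` until it contains `u 0`, then cancel that vector: the other `u j` are orthogonal
    -- to it, hence lie in the span of the remaining members.
    obtain ⟨v', q', hv', hspan, hw, i, hi⟩ := exists_contains h2 hB hsq hpair _ v q hv x le_rfl (by
      rw [hx, hu.norm]
      exact (p 0).ne_zero)
    rw [hx] at hi
    let e := Equiv.swap 0 i
    have hv'' := hv'.comp_injective e.injective
    have he : (v' ∘ e) 0 = u 0 := by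
      simp only [Function.comp_apply, e, Equiv.swap_apply_left, hi]
    have hq0 : (q' ∘ e) 0 = p 0 := Units.ext (by rw [← hu.norm, ← he, hv''.norm])
    have hmem : ∀ j : Fin n, u j.succ ∈ Submodule.span F (Set.range ((v' ∘ e) ∘ Fin.succ)) := by
      intro j
      have h1 : u j.succ ∈ Submodule.span F (Set.range (v' ∘ e)) := by
        rw [e.surjective.range_comp]
        refine Submodule.span_le.2 ?_ (huv j.succ)
        rintro _ ⟨k, rfl⟩
        exact hspan k
      obtain ⟨c, hc⟩ := (Submodule.mem_span_range_iff_exists_fun F).1 h1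
      have h0 := hv''.sum_left c 0
      rw [hc, he, hu.ortho _ _ (Fin.succ_ne_zero j)] at h0
      have hc0 : c 0 = 0 := (mul_eq_zero.1 h0.symm).resolve_right (Units.ne_zero _)
      rw [← hc, Fin.sum_univ_succ, hc0, zero_smul, zero_add]
      exact sum_mem fun k _ => Submodule.smul_mem _ _ (Submodule.subset_span ⟨k, rfl⟩)
    have htail := ih (hu.comp_injective (Fin.succ_injective n))
      (hv''.comp_injective (Fin.succ_injective n)) hmem
    calc ∏ i, w (p i) = w (p 0) * ∏ i : Fin n, w ((p ∘ Fin.succ) i) := Fin.prod_univ_succ _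
      _ = ∏ i, w ((q' ∘ e) i) := by
        rw [htail, Fin.prod_univ_succ fun i => w ((q' ∘ e) i), hq0]
        rfl
      _ = ∏ i, w (q' i) := Equiv.prod_comp e fun i => w (q' i)
      _ = ∏ i, w (q i) := hw

end IsOrthoFamily

end ChainEquivalence

/-! ### Equivariant functions and the form `∑ f(x) g(x)`. -/

section Equivariant

variable {Γ E X : Type*} [Group Γ] [Field E] [MulSemiringAction Γ E]

/-- The functions `f : X → E` commuting with the actions of `Γ`, as a space over the fixed field. -/
def equivariantFun (E : Type*) [Field E] [MulSemiringAction Γ E] (ρ : Γ →* Equiv.Perm X) :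
    Submodule (FixedPoints.subfield Γ E) (X → E) where
  carrier := {f | ∀ σ x, σ • f x = f (ρ σ x)}
  zero_mem' σ x := smul_zero σ
  add_mem' {f g} hf hg σ x := by
    simp only [Pi.add_apply, smul_add, hf σ x, hg σ x]
  smul_mem' c f hf σ x := by
    change σ • ((c : E) * f x) = c * f (ρ σ x)
    rw [smul_mul', hf σ x, c.2 σ]

variable {ρ : Γ →* Equiv.Perm X}

theorem smul_sum_comp [Fintype X] {f : X → E} (hf : ∀ σ x, σ • f x = f (ρ σ x)) (σ : Γ) :
    σ • ∑ x, f x = ∑ x, f x := by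
  rw [Finset.smul_sum, ← Equiv.sum_comp (ρ σ) f]
  exact Finset.sum_congr rfl fun x _ => hf σ x

/-- The form `∑ x, f x * g x` on equivariant functions. -/
noncomputable def dotForm [Fintype X] (E : Type*) [Field E] [MulSemiringAction Γ E]
    (ρ : Γ →* Equiv.Perm X) :
    LinearMap.BilinForm (FixedPoints.subfield Γ E) (equivariantFun E ρ) :=
  LinearMap.mk₂ (FixedPoints.subfield Γ E)
    (fun f g => ⟨∑ x, f.1 x * g.1 x, fun σ => smul_sum_comp (ρ := ρ) (fun σ x => by
      rw [smul_mul', f.2 σ x, g.2 σ x]) σ⟩)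
    (fun f f' g => Subtype.ext (by
      change ∑ x, (f.1 x + f'.1 x) * g.1 x = ∑ x, f.1 x * g.1 x + ∑ x, f'.1 x * g.1 x
      simp only [add_mul, Finset.sum_add_distrib]))
    (fun c f g => Subtype.ext (by
      change ∑ x, (c : E) * f.1 x * g.1 x = c * ∑ x, f.1 x * g.1 x
      simp only [mul_assoc, Finset.mul_sum]))
    (fun f g g' => Subtype.ext (by
      change ∑ x, f.1 x * (g.1 x + g'.1 x) = ∑ x, f.1 x * g.1 x + ∑ x, f.1 x * g'.1 x
      simp only [mul_add, Finset.sum_add_distrib]))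
    (fun c f g => Subtype.ext (by
      change ∑ x, f.1 x * ((c : E) * g.1 x) = c * ∑ x, f.1 x * g.1 x
      simp only [mul_left_comm, Finset.mul_sum]))

theorem coe_dotForm [Fintype X] (f g : equivariantFun E ρ) :
    (dotForm E ρ f g : E) = ∑ x, f.1 x * g.1 x := rfl

theorem dotForm_comm [Fintype X] (f g : equivariantFun E ρ) :
    dotForm E ρ f g = dotForm E ρ g f :=
  Subtype.ext (Finset.sum_congr rfl fun _ _ => mul_comm _ _)

variable {ι : Type*} {v : ι → equivariantFun E ρ} {q : ι → (FixedPoints.subfield Γ E)ˣ}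

theorem IsOrthoFamily.sum_smul_mul [Fintype X] [Fintype ι] (h : IsOrthoFamily (dotForm E ρ) v q)
    (c : ι → E) (j : ι) :
    ∑ x, (∑ i, c i • (v i : X → E)) x * (v j).1 x = c j * q j := by
  have h1 : ∀ x, (∑ i, c i • (v i : X → E)) x * (v j).1 x =
      ∑ i, c i * ((v i).1 x * (v j).1 x) := fun x => by
    rw [Finset.sum_apply, Finset.sum_mul]
    exact Finset.sum_congr rfl fun i _ => by rw [Pi.smul_apply, smul_eq_mul, mul_assoc]
  rw [Finset.sum_congr rfl fun x _ => h1 x, Finset.sum_comm, Finset.sum_eq_single j]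
  · rw [← Finset.mul_sum, ← coe_dotForm, h.norm]
  · intro i _ hij
    rw [← Finset.mul_sum, ← coe_dotForm, h.ortho i j hij]
    simp
  · exact fun hj => absurd (Finset.mem_univ j) hj

theorem IsOrthoFamily.linearIndependent [Fintype X] [Fintype ι]
    (h : IsOrthoFamily (dotForm E ρ) v q) : LinearIndependent E fun i => (v i : X → E) := by
  refine Fintype.linearIndependent_iff.2 fun c hc j => ?_
  have h1 := h.sum_smul_mul c j
  rw [hc] at h1
  simp only [Pi.zero_apply, zero_mul, Finset.sum_const_zero] at h1
  exact (mul_eq_zero.1 h1.symm).resolve_right (by simp)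

/-- By counting, the family is an `E`-basis of all functions. The coefficients of `u` are `B(u, v j)
/ q j`, which already lie in the fixed field. -/
theorem IsOrthoFamily.mem_span [Fintype X] [Fintype ι]
    (h : IsOrthoFamily (dotForm E ρ) v q) (hcard : Fintype.card ι = Fintype.card X)
    (u : equivariantFun E ρ) :
    u ∈ Submodule.span (FixedPoints.subfield Γ E) (Set.range v) := by
  have htop := h.linearIndependent.span_eq_top_of_card_eq_finrank'
    (by rw [hcard, Module.finrank_fintype_fun_eq_card])
  have hu : (u : X → E) ∈ Submodule.span E (Set.range fun i => (v i : X → E)) := by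
    rw [htop]
    trivial
  obtain ⟨c, hc⟩ := (Submodule.mem_span_range_iff_exists_fun E).1 hu
  have hcj : ∀ j, c j = (dotForm E ρ u (v j) * ((q j)⁻¹ : (FixedPoints.subfield Γ E)ˣ) :
      FixedPoints.subfield Γ E) := fun j => by
    have h1 := h.sum_smul_mul c j
    rw [hc, ← coe_dotForm] at h1
    have h3 : ((q j : FixedPoints.subfield Γ E) : E) ≠ 0 := by simp
    apply mul_right_cancel₀ h3
    rw [← h1, ← Subfield.coe_mul, mul_assoc, Units.inv_mul, mul_one]
  have : u = ∑ j, (dotForm E ρ u (v j) * ((q j)⁻¹ : (FixedPoints.subfield Γ E)ˣ) :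
      FixedPoints.subfield Γ E) • v j := by
    apply Subtype.ext
    rw [← hc, AddSubmonoidClass.coe_finsetSum]
    refine Finset.sum_congr rfl fun j _ => ?_
    rw [hcj]
    rfl
  rw [this]
  exact sum_mem fun j _ => Submodule.smul_mem _ _ (Submodule.subset_span ⟨j, rfl⟩)

/-- If the equivariant functions span all functions on `X`, then they have an orthogonal basis with
`|X|` elements. -/
theorem exists_isOrthoFamily [Fintype X] (h2 : (2 : E) ≠ 0)
    (hspan : Submodule.span E (equivariantFun E ρ : Set (X → E)) = ⊤) :
    ∃ (v : Fin (Fintype.card X) → equivariantFun E ρ)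
      (q : Fin (Fintype.card X) → (FixedPoints.subfield Γ E)ˣ),
      IsOrthoFamily (dotForm E ρ) v q := by
  classical
  let F := FixedPoints.subfield Γ E
  let b := Module.Basis.ofSpan hspan.ge
  have hb : ∀ i, b i ∈ equivariantFun E ρ := fun i =>
    Module.Basis.ofSpan_subset hspan.ge ⟨i, rfl⟩
  have hfin := Module.Finite.finite_basis b
  have := Fintype.ofFinite ((linearIndepOn_empty E id).extend
    (Set.empty_subset (equivariantFun E ρ : Set (X → E))))
  let b' : _ → equivariantFun E ρ := fun i => ⟨b i, hb i⟩
  have hzero : ∀ f : equivariantFun E ρ, (∀ i, dotForm E ρ f (b' i) = 0) → f = 0 := by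
    intro f hf
    have h1 : ∀ g : X → E, ∑ x, f.1 x * g x = 0 := fun g => by
      rw [← b.sum_repr g]
      have h3 : ∀ x, f.1 x * (∑ i, b.repr g i • b i) x =
          ∑ i, b.repr g i * (f.1 x * b i x) := fun x => by
        rw [Finset.sum_apply, Finset.mul_sum]
        exact Finset.sum_congr rfl fun i _ => by
          rw [Pi.smul_apply, smul_eq_mul, mul_left_comm]
      rw [Finset.sum_congr rfl fun x _ => h3 x, Finset.sum_comm]
      refine Finset.sum_eq_zero fun i _ => ?_
      rw [← Finset.mul_sum]
      have h4 : ∑ x, f.1 x * b i x = 0 := congrArg Subtype.val (hf i)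
      rw [h4, mul_zero]
    apply Subtype.ext
    funext x
    have := h1 (Pi.single x 1)
    simpa [Pi.single_apply] using this
  -- Pairing with an equivariant basis bounds the dimension over `F` by `|X|`; independence of that
  -- basis gives the reverse bound.
  let T : equivariantFun E ρ →ₗ[F] (_ → F) := LinearMap.pi fun i => (dotForm E ρ).flip (b' i)
  have hT : Function.Injective T := (injective_iff_map_eq_zero T).2 fun f hf =>
    hzero f fun i => congrFun hf i
  have hcardb : Fintype.card _ = Fintype.card X :=
    (Module.finrank_eq_card_basis b).symm.trans (Module.finrank_fintype_fun_eq_card E)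
  have hfd : FiniteDimensional F (equivariantFun E ρ) := FiniteDimensional.of_injective T hT
  have hle : Module.finrank F (equivariantFun E ρ) ≤ Fintype.card X := by
    have := LinearMap.finrank_le_finrank_of_injective hT
    rwa [Module.finrank_fintype_fun_eq_card, hcardb] at this
  have hli : LinearIndependent F b' := by
    have h1 : LinearIndependent F b := b.linearIndependent.restrict_scalars (by
      intro x y hxy
      exact Subtype.ext (by simpa [Subfield.smul_def] using hxy))
    exact LinearIndependent.of_comp (equivariantFun E ρ).subtype h1
  have hge : Fintype.card X ≤ Module.finrank F (equivariantFun E ρ) := by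
    rw [← hcardb]
    exact hli.fintype_card_le_finrank
  have h2F : (2 : F) ≠ 0 := fun h => h2 (congrArg Subtype.val h)
  have := invertibleOfNonzero h2F
  obtain ⟨v, hv⟩ := LinearMap.BilinForm.exists_orthogonal_basis
    (B := dotForm E ρ) ⟨fun f g => dotForm_comm f g⟩
  have hv' := hv.not_isOrtho_basis_self_of_separatingLeft fun f hf => hzero f fun i => hf _
  let e := finCongr (le_antisymm hge hle)
  exact ⟨fun i => v (e i), fun i => Units.mk0 _ (hv' (e i)),
    ⟨fun i j hij => hv (e.injective.ne hij), fun i => rfl⟩⟩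

/-- Summation over the fibres of `p` is `E`-linear, surjective and preserves equivariance. This
carries the spanning property from a product to its factors. -/
theorem span_equivariantFun_of_surjective {Y : Type*} [Finite X] [Finite Y]
    {ρ' : Γ →* Equiv.Perm Y} {p : X → Y} (hp : Function.Surjective p)
    (hpρ : ∀ σ x, p (ρ σ x) = ρ' σ (p x))
    (hspan : Submodule.span E (equivariantFun E ρ : Set (X → E)) = ⊤) :
    Submodule.span E (equivariantFun E ρ' : Set (Y → E)) = ⊤ := by
  classical
  have := Fintype.ofFinite X
  have := Fintype.ofFinite Y
  let T : (X → E) →ₗ[E] (Y → E) :=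
    { toFun := fun f y => ∑ x, if p x = y then f x else 0
      map_add' := fun f g => by
        funext y
        simp only [Pi.add_apply, ← Finset.sum_add_distrib]
        exact Finset.sum_congr rfl fun x _ => by split_ifs <;> simp
      map_smul' := fun c f => by
        funext y
        simp only [Pi.smul_apply, RingHom.id_apply, smul_eq_mul, Finset.mul_sum, mul_ite,
          mul_zero] }
  have hT : LinearMap.range T = ⊤ := by
    rw [eq_top_iff, ← (Pi.basisFun E Y).span_eq, Submodule.span_le]
    rintro _ ⟨y, rfl⟩
    obtain ⟨x, rfl⟩ := hp y
    refine ⟨Pi.single x 1, funext fun y => ?_⟩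
    change ∑ x', (if p x' = y then (Pi.single x 1 : X → E) x' else 0) = _
    rw [Finset.sum_eq_single x]
    · simp only [Pi.single_eq_same, Pi.basisFun_apply, Pi.single_apply, eq_comm]
    · intro x' _ hx'
      simp [Pi.single_eq_of_ne hx']
    · exact fun h => absurd (Finset.mem_univ x) h
  rw [eq_top_iff, ← hT, LinearMap.range_eq_map, ← hspan, Submodule.map_span]
  refine Submodule.span_mono ?_
  rintro _ ⟨f, hf, rfl⟩ σ y
  change σ • ∑ x, (if p x = y then f x else 0) = ∑ x, if p x = ρ' σ y then f x else 0
  rw [Finset.smul_sum, ← Equiv.sum_comp (ρ σ) fun x => if p x = ρ' σ y then f x else 0]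
  refine Finset.sum_congr rfl fun x _ => ?_
  rw [hpρ, (ρ' σ).injective.eq_iff]
  split_ifs
  · exact hf σ x
  · exact smul_zero σ

/-! ### Hasse-Witt classes of equivariant sets. -/

section Invariant

variable [TopologicalSpace Γ] [IsTopologicalGroup Γ] [IsDiscreteQuadClosed Γ E]

theorem prod_ofH1_eq_of_isOrthoFamily [Fintype X] [Fintype ι] {κ : Type*} [Fintype κ]
    {u : κ → equivariantFun E ρ} {p : κ → (FixedPoints.subfield Γ E)ˣ}
    (hu : IsOrthoFamily (dotForm E ρ) u p) (hv : IsOrthoFamily (dotForm E ρ) v q)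
    (hι : Fintype.card ι = Fintype.card X) (hκ : Fintype.card κ = Fintype.card X) :
    ∏ i, TruncClass.ofH1 (fixedKummer (p i)) = ∏ i, TruncClass.ofH1 (fixedKummer (q i)) := by
  have h2 : (2 : FixedPoints.subfield Γ E) ≠ 0 := fun h =>
    IsDiscreteQuadClosed.two_ne_zero (Γ := Γ) (E := E) (congrArg Subtype.val h)
  let e := (Fintype.equivFinOfCardEq hι).symm
  let e' := (Fintype.equivFinOfCardEq hκ).symm
  have hv' := hv.comp_injective e.injective
  have := IsOrthoFamily.prod_eq_of_mem_span h2 dotForm_comm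
    (w := fun a => TruncClass.ofH1 (fixedKummer a))
    (fun a x => by rw [fixedKummer_mul_sq]) ofH1_fixedKummer_pair
    (hu.comp_injective e'.injective) hv'
    (fun i => hv'.mem_span (Fintype.card_fin _) _)
  rw [← Equiv.prod_comp e, ← Equiv.prod_comp e']
  exact this

/-- The determinant of the matrix of values `v i x` is a square root of `∏ q i`. An element `σ`
permutes the columns, so it multiplies this root by the sign of `ρ σ`, which is `1`. -/
theorem sum_fixedKummer_eq_zero [Fintype X] [DecidableEq X] [Fintype ι]
    (h : IsOrthoFamily (dotForm E ρ) v q)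
    (hcard : Fintype.card ι = Fintype.card X) (hsign : ∀ σ, Equiv.Perm.sign (ρ σ) = 1) :
    ∑ i, fixedKummer (q i) = 0 := by
  let e : X ≃ ι := Fintype.equivOfCardEq hcard.symm
  have he := h.comp_injective e.injective
  let P : Matrix X X E := Matrix.of fun i x => (v (e i)).1 x
  have hP : P * P.transpose = Matrix.diagonal fun i => (q (e i) : E) := by
    ext i j
    rw [Matrix.mul_apply]
    change ∑ x, (v (e i)).1 x * (v (e j)).1 x = _
    rw [← coe_dotForm]
    by_cases hij : i = j
    · rw [hij, Matrix.diagonal_apply_eq, h.norm]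
    · rw [Matrix.diagonal_apply_ne _ hij, h.ortho _ _ (e.injective.ne hij)]
      rfl
  have hdet : P.det ^ 2 = ((∏ i, q i : (FixedPoints.subfield Γ E)ˣ) : E) := by
    have h1 := congrArg Matrix.det hP
    rw [Matrix.det_mul, Matrix.det_transpose, Matrix.det_diagonal,
      Equiv.prod_comp e fun i => (q i : E)] at h1
    rw [sq, h1]
    simp
  rw [← fixedKummer_prod]
  refine fixedKummer_eq_zero _ hdet fun σ => ?_
  have h1 := (MulSemiringAction.toRingHom Γ E σ).map_det P
  change σ • P.det = _ at h1
  have h3 : (MulSemiringAction.toRingHom Γ E σ).mapMatrix P = P.submatrix id (ρ σ) := by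
    ext i x
    exact (v (e i)).2 σ x
  rw [h1, h3, Matrix.det_permute', hsign]
  simp

/-- The invariants of a product of two equivariant sets, if `Γ` acts on the first one by even
permutations, its cardinality is divisible by four, and the second one has even cardinality. -/
theorem prod_ofH1_eq_one [Fintype X] [Fintype ι] {X₁ X₂ : Type*} [Fintype X₁] [DecidableEq X₁]
    [Fintype X₂] {ρ₁ : Γ →* Equiv.Perm X₁} {ρ₂ : Γ →* Equiv.Perm X₂} (e : X ≃ X₁ × X₂)
    (he : ∀ σ x, e (ρ σ x) = (ρ₁ σ (e x).1, ρ₂ σ (e x).2))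
    (hspan : Submodule.span E (equivariantFun E ρ : Set (X → E)) = ⊤)
    (hsign : ∀ σ, Equiv.Perm.sign (ρ₁ σ) = 1) (h₁ : 4 ∣ Fintype.card X₁)
    (h₂ : Even (Fintype.card X₂)) (hne : Nonempty X)
    (h : IsOrthoFamily (dotForm E ρ) v q) (hcard : Fintype.card ι = Fintype.card X) :
    ∏ i, TruncClass.ofH1 (fixedKummer (q i)) = 1 := by
  have h2 : (2 : E) ≠ 0 := IsDiscreteQuadClosed.two_ne_zero Γ
  obtain ⟨x₀⟩ := hne
  have hspan₁ : Submodule.span E (equivariantFun E ρ₁ : Set (X₁ → E)) = ⊤ :=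
    span_equivariantFun_of_surjective (p := fun x => (e x).1)
      (fun x => ⟨e.symm (x, (e x₀).2), by simp⟩) (fun σ x => by rw [he]) hspan
  have hspan₂ : Submodule.span E (equivariantFun E ρ₂ : Set (X₂ → E)) = ⊤ :=
    span_equivariantFun_of_surjective (p := fun x => (e x).2)
      (fun x => ⟨e.symm ((e x₀).1, x), by simp⟩) (fun σ x => by rw [he]) hspan
  obtain ⟨v₁, q₁, hv₁⟩ := exists_isOrthoFamily h2 hspan₁
  obtain ⟨v₂, q₂, hv₂⟩ := exists_isOrthoFamily h2 hspan₂
  -- Products of vectors from the two factors diagonalise the tensor product form.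
  let u : Fin (Fintype.card X₂) × Fin (Fintype.card X₁) → equivariantFun E ρ := fun i =>
    ⟨fun x => (v₁ i.2).1 (e x).1 * (v₂ i.1).1 (e x).2, fun σ x => by
      simp only [smul_mul', (v₁ i.2).2 σ, (v₂ i.1).2 σ, he]⟩
  have hdot : ∀ i j, dotForm E ρ (u i) (u j) =
      dotForm E ρ₁ (v₁ i.2) (v₁ j.2) * dotForm E ρ₂ (v₂ i.1) (v₂ j.1) := fun i j => by
    apply Subtype.ext
    rw [Subfield.coe_mul, coe_dotForm, coe_dotForm, coe_dotForm, Finset.sum_mul_sum,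
      ← Finset.sum_product', Finset.univ_product_univ, ← Equiv.sum_comp e]
    exact Finset.sum_congr rfl fun x _ => by
      simp only [u]
      ring
  have hu : IsOrthoFamily (dotForm E ρ) u fun i => q₁ i.2 * q₂ i.1 := by
    refine ⟨fun i j hij => ?_, fun i => ?_⟩
    · rw [hdot]
      by_cases h3 : i.2 = j.2
      · rw [hv₂.ortho i.1 j.1 (fun h4 => hij (Prod.ext h4 h3)), mul_zero]
      · rw [hv₁.ortho _ _ h3, zero_mul]
    · rw [hdot, hv₁.norm, hv₂.norm, Units.val_mul]
  have hsum := sum_fixedKummer_eq_zero hv₁ (Fintype.card_fin _) hsign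
  rw [prod_ofH1_eq_of_isOrthoFamily h hu (by
    rw [Fintype.card_congr e, Fintype.card_prod, Fintype.card_prod, Fintype.card_fin,
      Fintype.card_fin, mul_comm]) hcard, Fintype.prod_prod_type]
  simp only [fixedKummer_mul]
  -- Each block `q₂ j · q₁` has the class of `q₁`, leaving that class to the power `|X₂|`, which is
  -- even.
  rw [Finset.prod_congr rfl fun j _ => TruncClass.prod_ofH1_add_eq Finset.univ
    (fun i => fixedKummer (q₁ i)) (fixedKummer (q₂ j)) (by simpa using h₁) hsum]
  rw [Finset.prod_const, Finset.card_univ, Fintype.card_fin]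
  obtain ⟨k, hk⟩ := h₂
  rw [hk, pow_add, ← mul_pow]
  suffices hsq : (∏ i, TruncClass.ofH1 (fixedKummer (q₁ i))) *
      ∏ i, TruncClass.ofH1 (fixedKummer (q₁ i)) = 1 by rw [hsq, one_pow]
  ext1
  · rw [TruncClass.mul_one', contH1_add_self, TruncClass.one_one]
  · rw [TruncClass.mul_two, contH2_add_self, TruncClass.prod_one, hsum, cupH1_zero_left,
      TruncClass.one_two, add_zero]

end Invariant

end Equivariant

/-! ### Direct products, signs of translations and odd orbits. -/

section GroupTheory

theorem IsInternalDirectProduct.symm {S : Type*} [Group S] {G₁ G₂ : Subgroup S}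
    (h : IsInternalDirectProduct G₁ G₂) : IsInternalDirectProduct G₂ G₁ :=
  ⟨fun x hx y hy => (h.1 y hy x hx).symm, by rw [inf_comm, h.2.1], by rw [sup_comm, h.2.2]⟩

theorem IsInternalDirectProduct.exists_mulEquiv {S : Type*} [Group S] {G₁ G₂ : Subgroup S}
    (h : IsInternalDirectProduct G₁ G₂) : Nonempty (S ≃* G₁ × G₂) := by
  have hcomm : ∀ (x : G₁) (y : G₂), Commute (G₁.subtype x) (G₂.subtype y) := fun x y =>
    h.1 x x.2 y y.2
  let f := MonoidHom.noncommCoprod G₁.subtype G₂.subtype hcomm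
  refine ⟨(MulEquiv.ofBijective f ⟨?_, ?_⟩).symm⟩
  · refine (MonoidHom.noncommCoprod_injective _ _ _).2
      ⟨G₁.subtype_injective, G₂.subtype_injective, ?_⟩
    rw [Subgroup.range_subtype, Subgroup.range_subtype, disjoint_iff, h.2.1]
  · rw [← MonoidHom.range_eq_top, MonoidHom.noncommCoprod_range, Subgroup.range_subtype,
      Subgroup.range_subtype, h.2.2]

/-- A finite abelian group that is not metacyclic splits off a nontrivial direct factor with
non-cyclic complement. -/
theorem exists_isInternalDirectProduct_of_not_isMetacyclic {S : Type*} [Group S] [Finite S]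
    (hcomm : ∀ x y : S, x * y = y * x) (hS : ¬ IsMetacyclic S) :
    ∃ G₁ G₂ : Subgroup S, IsInternalDirectProduct G₁ G₂ ∧ ¬ IsCyclic G₁ ∧ G₂ ≠ ⊥ := by
  classical
  let _ : CommGroup S := { ‹Group S› with mul_comm := hcomm }
  obtain ⟨ι, _, n, hn, ⟨f⟩⟩ := CommGroup.equiv_prod_multiplicative_zmod_of_finite S
  rcases isEmpty_or_nonempty ι with hι | ⟨⟨i⟩⟩
  · have : Subsingleton S := f.toEquiv.subsingleton
    have : Subsingleton (S ⧸ (⊥ : Subgroup S)) := Quotient.instSubsingletonQuotient _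
    exact absurd ⟨⊥, inferInstance, isCyclic_of_subsingleton, isCyclic_of_subsingleton⟩ hS
  -- Split off one cyclic factor, with projection `π` and section `j`. A cyclic kernel of `π` would
  -- exhibit `S` as metacyclic.
  · let π : S →* Multiplicative (ZMod (n i)) := (Pi.evalMonoidHom _ i).comp f.toMonoidHom
    let j : Multiplicative (ZMod (n i)) →* S :=
      f.symm.toMonoidHom.comp (MonoidHom.mulSingle (fun i => Multiplicative (ZMod (n i))) i)
    have hπj : ∀ a, π (j a) = a := fun a => by
      change f (f.symm (Pi.mulSingle i a)) i = a
      rw [f.apply_symm_apply, Pi.mulSingle_eq_same]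
    refine ⟨π.ker, j.range, ⟨fun x _ y _ => hcomm x y, ?_, ?_⟩, fun hcyc => hS ?_, fun hbot => ?_⟩
    · rw [eq_bot_iff]
      rintro _ ⟨hx, a, rfl⟩
      have ha : π (j a) = 1 := hx
      rw [hπj] at ha
      rw [ha, map_one]
      exact Subgroup.one_mem _
    · rw [eq_top_iff]
      intro x _
      have hx : x = x * (j (π x))⁻¹ * j (π x) := by rw [inv_mul_cancel_right]
      rw [hx]
      refine Subgroup.mul_mem_sup ?_ ⟨_, rfl⟩
      rw [MonoidHom.mem_ker, map_mul, map_inv, hπj, mul_inv_cancel]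
    · exact ⟨π.ker, inferInstance, hcyc,
        isCyclic_of_injective (QuotientGroup.kerLift π) (QuotientGroup.kerLift_injective π)⟩
    · have : Fact (1 < n i) := ⟨hn i⟩
      have h1 : j (Multiplicative.ofAdd 1) ∈ (⊥ : Subgroup S) := hbot ▸ ⟨_, rfl⟩
      have h2 := hπj (Multiplicative.ofAdd 1)
      rw [Subgroup.mem_bot.1 h1, map_one] at h2
      exact one_ne_zero (congrArg Multiplicative.toAdd h2).symm

/-- A group as a set with left action of a subgroup `H` is a union of copies of `H`. -/
noncomputable def Subgroup.prodEquivOfLeftMul {G : Type*} [Group G] (H : Subgroup G) :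
    G ≃ H × (G ⧸ H) where
  -- The orbits of left translation are the cosets `Hx`; inversion turns them into the cosets that
  -- `G ⧸ H` records.
  toFun x := (⟨x * ((x⁻¹ : G) : G ⧸ H).out, by
    have h1 := H.inv_mem (QuotientGroup.eq.1 (Quotient.out_eq' ((x⁻¹ : G) : G ⧸ H)))
    rwa [mul_inv_rev, inv_inv, inv_inv] at h1⟩, (x⁻¹ : G))
  invFun p := p.1 * p.2.out⁻¹
  left_inv x := by simp
  right_inv p := by
    have h1 : ((((p.1 : G) * p.2.out⁻¹)⁻¹ : G) : G ⧸ H) = p.2 := by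
      rw [mul_inv_rev, inv_inv]
      conv_rhs => rw [← Quotient.out_eq' p.2]
      refine QuotientGroup.eq.2 ?_
      simp
    refine Prod.ext (Subtype.ext ?_) h1
    change (p.1 : G) * p.2.out⁻¹ * ((((p.1 : G) * p.2.out⁻¹)⁻¹ : G) : G ⧸ H).out = p.1
    rw [h1, inv_mul_cancel_right]

theorem Subgroup.prodEquivOfLeftMul_mul {G : Type*} [Group G] (H : Subgroup G) (h : H) (x : G) :
    H.prodEquivOfLeftMul (h * x) =
      (h * (H.prodEquivOfLeftMul x).1, (H.prodEquivOfLeftMul x).2) := by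
  have h1 : (((h * x : G)⁻¹ : G) : G ⧸ H) = (x⁻¹ : G) := by
    refine QuotientGroup.eq.2 ?_
    simp
  refine Prod.ext (Subtype.ext ?_) h1
  change (h * x : G) * (((h * x : G)⁻¹ : G) : G ⧸ H).out = h * (x * ((x⁻¹ : G) : G ⧸ H).out)
  rw [h1, mul_assoc]

/-- The permutation is the same translation of `H` repeated once for each coset, so its sign is a
power with exponent the index. -/
theorem Subgroup.sign_mulLeft {G : Type*} [Group G] [Fintype G] [DecidableEq G] (H : Subgroup G)
    (hH : Even H.index) (h : H) : Equiv.Perm.sign (Equiv.mulLeft (h : G)) = 1 := by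
  classical
  let e : G ≃ (G ⧸ H) × H := H.prodEquivOfLeftMul.trans (Equiv.prodComm _ _)
  have he : (e.symm.trans (Equiv.mulLeft (h : G))).trans e =
      Equiv.prodCongrRight fun _ : G ⧸ H => Equiv.mulLeft h := by
    ext1 p
    obtain ⟨x, rfl⟩ := e.surjective p
    change e (h * e.symm (e x)) = _
    rw [e.symm_apply_apply]
    change (Equiv.prodComm _ _) (H.prodEquivOfLeftMul (h * x)) = _
    rw [H.prodEquivOfLeftMul_mul]
    rfl
  rw [← Equiv.Perm.sign_symm_trans_trans (Equiv.mulLeft (h : G)) e, he,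
    Equiv.Perm.sign_prodCongrRight, Finset.prod_const, Finset.card_univ, ← Nat.card_eq_fintype_card]
  obtain ⟨k, hk⟩ := hH
  change _ ^ H.index = _
  rw [hk, pow_add, ← mul_pow, Int.units_mul_self, one_pow]

/-- Left translations of a non-cyclic `2`-group are even permutations. -/
theorem IsPGroup.sign_mulLeft {G : Type*} [Group G] [Fintype G] [DecidableEq G]
    (hG : IsPGroup 2 G) (hcyc : ¬ IsCyclic G) (g : G) : Equiv.Perm.sign (Equiv.mulLeft g) = 1 := by
  have : Fact (Nat.Prime 2) := ⟨Nat.prime_two⟩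
  refine (Subgroup.zpowers g).sign_mulLeft ?_ ⟨g, Subgroup.mem_zpowers g⟩
  obtain ⟨k, hk⟩ := hG.index (Subgroup.zpowers g)
  rcases k with _ | k
  · refine absurd ⟨g, fun x => ?_⟩ hcyc
    rw [pow_zero, Subgroup.index_eq_one] at hk
    have hx : x ∈ Subgroup.zpowers g := by
      rw [hk]
      trivial
    exact hx
  · rw [hk, pow_succ]
    exact even_iff_two_dvd.2 (dvd_mul_left _ _)

theorem IsPGroup.four_dvd_card {G : Type*} [Group G] [Finite G] (hG : IsPGroup 2 G)
    (hcyc : ¬ IsCyclic G) : 4 ∣ Nat.card G := by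
  have : Fact (Nat.Prime 2) := ⟨Nat.prime_two⟩
  obtain ⟨k, hk⟩ := IsPGroup.iff_card.1 hG
  rcases k with _ | _ | k
  · have : Subsingleton G := (Nat.card_eq_one_iff_unique.1 (hk.trans (pow_zero 2))).1
    exact absurd isCyclic_of_subsingleton hcyc
  · exact absurd (isCyclic_of_prime_card (hk.trans (pow_one 2))) hcyc
  · exact ⟨2 ^ k, by rw [hk]; ring⟩

theorem IsPGroup.even_card {G : Type*} [Group G] [Finite G] (hG : IsPGroup 2 G)
    (hnt : Nontrivial G) : Even (Nat.card G) := by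
  have : Fact (Nat.Prime 2) := ⟨Nat.prime_two⟩
  obtain ⟨k, hk, h⟩ := hG.nontrivial_iff_card.1 hnt
  rw [h]
  exact (even_two).pow_of_ne_zero hk.ne'

/-- A group acting on a set with an odd number of elements has an orbit of odd length. -/
theorem exists_odd_index_stabilizer {Γ X : Type*} [Group Γ] [MulAction Γ X] [Finite X]
    (hodd : Odd (Nat.card X)) : ∃ x : X, Odd (MulAction.stabilizer Γ x).index := by
  classical
  have := Fintype.ofFinite X
  by_contra! hall
  have hΩ : Finite (MulAction.orbitRel.Quotient Γ X) := Quotient.finite _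
  have := Fintype.ofFinite (MulAction.orbitRel.Quotient Γ X)
  have h1 : Nat.card X = ∑ ω : MulAction.orbitRel.Quotient Γ X,
      Nat.card (MulAction.orbit Γ ω.out) := by
    rw [Nat.card_congr (MulAction.selfEquivSigmaOrbits Γ X), Nat.card_sigma]
  rw [h1, ← Nat.not_even_iff_odd] at hodd
  refine hodd (Finset.even_sum _ fun ω _ => ?_)
  have h2 := hall ω.out
  rw [MulAction.index_stabilizer, Nat.not_odd_iff_even] at h2
  exact h2

end GroupTheory

/-! ### Galois algebras and their geometric points. -/

section GaloisAlgebra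

variable {K Ks G L : Type*} [Field K] [Field Ks] [Algebra K Ks] [Group G] [CommRing L]
  [Algebra K L] [MulSemiringAction G L]

namespace IsGaloisAlgebra

theorem finite [Finite G] (hL : IsGaloisAlgebra K Ks G L) : Module.Finite K L :=
  Module.finite_of_finrank_pos (by rw [hL.finrank_eq]; exact Nat.card_pos)

/-- A residue field of an étale algebra is separable over `K`, so it embeds in `Ks`. This has to be
proved because `simply_transitive` is vacuous on an empty set. -/
theorem nonempty_algHom [Finite G] [IsSepClosed Ks] (hL : IsGaloisAlgebra K Ks G L) :
    Nonempty (L →ₐ[K] Ks) := by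
  have := hL.etale
  have : Nontrivial L := Module.nontrivial_of_finrank_pos (R := K)
    (by rw [hL.finrank_eq]; exact Nat.card_pos)
  obtain ⟨m, hm⟩ := Ideal.exists_maximal L
  let _ := Ideal.Quotient.field m
  have : Algebra.IsSeparable K (L ⧸ m) := inferInstance
  exact ⟨(IsSepClosed.lift : (L ⧸ m) →ₐ[K] Ks).comp (Ideal.Quotient.mkₐ K m)⟩

/-- The homomorphism `x ↦ χ (g • x)`. -/
def translate (hL : IsGaloisAlgebra K Ks G L) (χ : L →ₐ[K] Ks) (g : G) : L →ₐ[K] Ks :=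
  { χ.toRingHom.comp (MulSemiringAction.toRingHom G L g) with
    commutes' := fun x => by
      change χ (g • algebraMap K L x) = _
      rw [hL.smul_algebraMap, χ.commutes] }

theorem translate_apply (hL : IsGaloisAlgebra K Ks G L) (χ : L →ₐ[K] Ks) (g : G) (x : L) :
    hL.translate χ g x = χ (g • x) := rfl

theorem translate_injective (hL : IsGaloisAlgebra K Ks G L) (χ : L →ₐ[K] Ks) :
    Function.Injective (hL.translate χ) := fun _ _ h =>
  (hL.simply_transitive χ (hL.translate χ _)).unique (fun _ => rfl) fun x =>
    DFunLike.congr_fun h x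

/-- The homomorphism from the Galois group to `G` attached to a geometric point of `L`. -/
theorem exists_monoidHom (hL : IsGaloisAlgebra K Ks G L) (χ : L →ₐ[K] Ks) :
    ∃ φ : (Ks ≃ₐ[K] Ks) →* G, ∀ σ x, σ (χ x) = χ (φ σ • x) := by
  choose φ hφ hu using fun σ : Ks ≃ₐ[K] Ks => hL.simply_transitive χ (σ.toAlgHom.comp χ)
  replace hφ : ∀ (σ : Ks ≃ₐ[K] Ks) x, σ (χ x) = χ (φ σ • x) := hφ
  refine ⟨MonoidHom.mk' φ fun σ τ => (hu (σ * τ) _ fun x => ?_).symm, hφ⟩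
  change σ (τ (χ x)) = _
  rw [hφ, hφ, mul_smul]

section matrix

theorem exists_basis [Finite G] (hL : IsGaloisAlgebra K Ks G L) :
    Nonempty (Module.Basis G K L) := by
  have := hL.finite
  have := Fintype.ofFinite G
  exact ⟨(Module.finBasis K L).reindex (Fintype.equivOfCardEq (by
    rw [Fintype.card_fin, hL.finrank_eq, Nat.card_eq_fintype_card]))⟩

variable [Fintype G] [DecidableEq G]

/-- The homomorphisms `x ↦ χ (g • x)` are distinct by simple transitivity, hence linearly
independent by Dedekind, and so are the rows. -/
theorem isUnit_matrix (hL : IsGaloisAlgebra K Ks G L) (χ : L →ₐ[K] Ks) (b : Module.Basis G K L) :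
    IsUnit (Matrix.of fun g i => χ (g • b i) : Matrix G G Ks) := by
  rw [← Matrix.linearIndependent_rows_iff_isUnit, Fintype.linearIndependent_iff]
  intro c hc
  have h1 := (linearIndependent_toLinearMap K L Ks).comp _ (hL.translate_injective χ)
  refine Fintype.linearIndependent_iff.1 h1 c (b.ext fun i => ?_)
  have h2 := congrFun hc i
  rw [Finset.sum_apply] at h2
  rw [LinearMap.sum_apply]
  exact h2

/-- The invertible matrix `P` conjugates multiplication by `x` to the diagonal matrix with entries
`χ (g • x)`. -/
theorem algebraMap_trace (hL : IsGaloisAlgebra K Ks G L) (χ : L →ₐ[K] Ks) (x : L) :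
    algebraMap K Ks (Algebra.trace K L x) = ∑ g : G, χ (g • x) := by
  obtain ⟨b⟩ := hL.exists_basis
  let P : Matrix G G Ks := Matrix.of fun g i => χ (g • b i)
  have hP := hL.isUnit_matrix χ b
  let M := Algebra.leftMulMatrix b x
  have hM : ∀ j i, M j i = b.repr (x * b i) j := Algebra.leftMulMatrix_eq_repr_mul b x
  have hPM : P * M.map (algebraMap K Ks) = Matrix.diagonal (fun g => χ (g • x)) * P := by
    ext g i
    rw [Matrix.diagonal_mul, Matrix.mul_apply]
    change ∑ j, χ (g • b j) * algebraMap K Ks (M j i) = χ (g • x) * χ (g • b i)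
    rw [← map_mul, ← smul_mul', ← b.sum_repr (x * b i), Finset.smul_sum, map_sum]
    refine Finset.sum_congr rfl fun j _ => ?_
    rw [Algebra.smul_def, smul_mul', hL.smul_algebraMap, map_mul, χ.commutes, mul_comm, hM]
  have hdet : IsUnit P.det := (Matrix.isUnit_iff_isUnit_det P).1 hP
  rw [Algebra.trace_eq_matrix_trace b x]
  calc algebraMap K Ks M.trace = (M.map (algebraMap K Ks)).trace := by
        simp [Matrix.trace, map_sum]
    _ = (P⁻¹ * (P * M.map (algebraMap K Ks))).trace := by
        rw [← Matrix.mul_assoc, Matrix.nonsing_inv_mul P hdet, Matrix.one_mul]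
    _ = (Matrix.diagonal (fun g => χ (g • x))).trace := by
        rw [hPM, Matrix.trace_mul_comm, Matrix.mul_assoc, Matrix.mul_nonsing_inv P hdet,
          Matrix.mul_one]
    _ = _ := Matrix.trace_diagonal _

end matrix

/-- Left translation by the image of a homomorphism. -/
def leftPerm {Δ H : Type*} [Group Δ] [Group H] (φ : Δ →* H) : Δ →* Equiv.Perm H :=
  (MulAction.toPermHom H H).comp φ

theorem leftPerm_apply {Δ H : Type*} [Group Δ] [Group H] (φ : Δ →* H) (σ : Δ) (x : H) :
    leftPerm φ σ x = φ σ * x := rfl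

variable {Δ : Type*} [Group Δ] [MulSemiringAction Δ Ks]

/-- An element of `L` as an equivariant function on `G`. -/
def equivariantOf (χ : L →ₐ[K] Ks) {φ : Δ →* G} (hφ : ∀ σ x, σ • χ x = χ (φ σ • x)) (x : L) :
    equivariantFun Ks (leftPerm φ) :=
  ⟨fun g => χ (g • x), fun σ g => by simp only [hφ, leftPerm_apply, mul_smul]⟩

theorem span_equivariantFun_eq_top [Finite G] (hL : IsGaloisAlgebra K Ks G L) (χ : L →ₐ[K] Ks)
    {φ : Δ →* G} (hφ : ∀ σ x, σ • χ x = χ (φ σ • x)) :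
    Submodule.span Ks (equivariantFun Ks (leftPerm φ) : Set (G → Ks)) = ⊤ := by
  classical
  have := Fintype.ofFinite G
  obtain ⟨b⟩ := hL.exists_basis
  have h1 := Matrix.linearIndependent_cols_iff_isUnit.2 (hL.isUnit_matrix χ b)
  have h2 := h1.span_eq_top_of_card_eq_finrank' (by rw [Module.finrank_fintype_fun_eq_card])
  rw [eq_top_iff, ← h2]
  refine Submodule.span_mono ?_
  rintro _ ⟨i, rfl⟩
  exact (equivariantOf χ hφ (b i)).2

theorem coe_dotForm_equivariantOf [Fintype G] (hL : IsGaloisAlgebra K Ks G L) (χ : L →ₐ[K] Ks)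
    {φ : Δ →* G} (hφ : ∀ σ x, σ • χ x = χ (φ σ • x)) (x y : L) :
    (dotForm Ks (leftPerm φ) (equivariantOf χ hφ x) (equivariantOf χ hφ y) : Ks) =
      algebraMap K Ks (Algebra.traceForm K L x y) := by
  classical
  rw [Algebra.traceForm_apply, hL.algebraMap_trace χ, coe_dotForm]
  refine Finset.sum_congr rfl fun g _ => ?_
  change χ (g • x) * χ (g • y) = _
  rw [smul_mul', map_mul]

/-- Only non-degeneracy needs work: if `x` is orthogonal to `L`, the invertible matrix of
`isUnit_matrix` kills the vector of the `χ (g • x)`, and these values determine `x`. -/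
theorem exists_isDiagonalisation [Finite G] [IsSepClosed Ks] (h2 : (2 : K) ≠ 0)
    (hL : IsGaloisAlgebra K Ks G L) :
    ∃ (n : ℕ) (a : Fin n → Kˣ), IsDiagonalisation (galTraceForm K L) a := by
  classical
  have := Fintype.ofFinite G
  have := hL.finite
  obtain ⟨χ⟩ := hL.nonempty_algHom
  have := invertibleOfNonzero h2
  have hsep : (QuadraticMap.associated (R := K) (galTraceForm K L)).SeparatingLeft := by
    intro x hx
    have hx' : ∀ y, Algebra.trace K L (x * y) = 0 := fun y => by
      have h1 := hx y
      rw [galTraceForm, QuadraticMap.associated_left_inverse _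
        (fun x y => (Algebra.traceForm_isSymm K).eq x y)] at h1
      exact h1
    obtain ⟨b⟩ := hL.exists_basis
    have h0 : Matrix.vecMul (fun g : G => χ (g • x)) (Matrix.of fun g i => χ (g • b i)) = 0 := by
      funext i
      change ∑ g : G, χ (g • x) * χ (g • b i) = 0
      simp only [← map_mul, ← smul_mul']
      rw [← hL.algebraMap_trace χ, hx', map_zero]
    have h3 := Matrix.vecMul_injective_of_isUnit (hL.isUnit_matrix χ b)
      (h0.trans (Matrix.zero_vecMul _).symm)
    have hinj : ∀ y : L, (∀ g : G, χ (g • y) = 0) → y = 0 := fun y hy => by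
      have h4 : Matrix.mulVec (Matrix.of fun (g i : G) => χ (g • b i))
          (fun i => algebraMap K Ks (b.repr y i)) = 0 := by
        funext g
        change ∑ i, χ (g • b i) * algebraMap K Ks (b.repr y i) = 0
        rw [← hy g]
        conv_rhs => rw [← b.sum_repr y, Finset.smul_sum, map_sum]
        refine Finset.sum_congr rfl fun i _ => ?_
        rw [Algebra.smul_def, smul_mul', hL.smul_algebraMap, map_mul, χ.commutes, mul_comm]
      have h5 := Matrix.mulVec_injective_of_isUnit (hL.isUnit_matrix χ b)
        (h4.trans (Matrix.mulVec_zero _).symm)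
      refine b.ext_elem fun i => ?_
      rw [map_zero]
      exact (map_eq_zero _).1 (congrFun h5 i)
    exact hinj x fun g => congrFun h3 g
  obtain ⟨w, hw⟩ :=
    (galTraceForm K L).equivalent_weightedSumSquares_units_of_nondegenerate' hsep
  refine ⟨_, w, ?_⟩
  unfold IsDiagonalisation
  convert! hw using 1

end IsGaloisAlgebra

/-- A diagonalisation is an orthogonal basis for the trace form. -/
theorem IsDiagonalisation.exists_traceForm (h2 : (2 : K) ≠ 0) {n : ℕ} {a : Fin n → Kˣ}
    (h : IsDiagonalisation (galTraceForm K L) a) :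
    n = Module.finrank K L ∧ ∃ v : Fin n → L,
      (∀ i j, i ≠ j → Algebra.traceForm K L (v i) (v j) = 0) ∧
      ∀ i, Algebra.traceForm K L (v i) (v i) = a i := by
  classical
  obtain ⟨e⟩ := h
  refine ⟨by rw [e.toLinearEquiv.finrank_eq, Module.finrank_fin_fun], ?_⟩
  let s : Fin n → Fin n → K := fun i => Pi.single i 1
  have hQ : ∀ y, galTraceForm K L (e.symm y) = ∑ i, (a i : K) * (y i * y i) := fun y => by
    rw [e.symm.map_app, QuadraticMap.weightedSumSquares_apply]
    rfl
  have hself : ∀ x, Algebra.traceForm K L x x = galTraceForm K L x := fun x => rfl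
  have hnorm : ∀ i, galTraceForm K L (e.symm (s i)) = a i := fun i => by
    rw [hQ, Finset.sum_eq_single i]
    · simp [s]
    · intro j _ hji
      simp [s, hji]
    · exact fun hi => absurd (Finset.mem_univ i) hi
  refine ⟨fun i => e.symm (s i), fun i j hij => ?_, hnorm⟩
  have hadd : galTraceForm K L (e.symm (s i + s j)) = a i + a j := by
    rw [hQ, ← Finset.sum_subset (Finset.subset_univ {i, j}) fun k _ hk => ?_,
      Finset.sum_pair hij]
    · simp [s, hij, hij.symm]
    · simp only [Finset.mem_insert, Finset.mem_singleton, not_or] at hk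
      simp [s, hk.1, hk.2]
  have hexp : galTraceForm K L (e.symm (s i + s j)) = galTraceForm K L (e.symm (s i)) +
      galTraceForm K L (e.symm (s j)) +
        2 * Algebra.traceForm K L (e.symm (s i)) (e.symm (s j)) := by
    have h3 : e.symm (s i + s j) = e.symm (s i) + e.symm (s j) :=
      e.symm.toLinearEquiv.map_add _ _
    rw [h3]
    simp only [galTraceForm_apply, Algebra.traceForm_apply]
    rw [add_sq, map_add, map_add, mul_assoc, two_mul (_ * _), map_add]
    ring
  rw [hadd, hnorm, hnorm, left_eq_add] at hexp
  exact (mul_eq_zero.1 hexp).resolve_left h2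

end GaloisAlgebra

/-! ### Reduction to the Sylow subgroup and conclusion. -/

section Main

variable {K Ks G L : Type*} [Field K] [Field Ks] [Algebra K Ks] [Group G] [CommRing L]
  [Algebra K L] [MulSemiringAction G L]

theorem isDiscreteQuadClosed_gal [IsSepClosure K Ks] (h2 : (2 : K) ≠ 0) :
    IsDiscreteQuadClosed (Ks ≃ₐ[K] Ks) Ks := by
  have hsep : Algebra.IsSeparable K Ks := IsSepClosure.separable
  have hclosed : IsSepClosed Ks := IsSepClosure.sep_closed K
  have h2' : (2 : Ks) ≠ 0 := fun h =>
    h2 ((algebraMap K Ks).injective (by rw [map_ofNat, map_zero, h]))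
  have : NeZero ((2 : ℕ) : Ks) := ⟨by exact_mod_cast h2'⟩
  exact ⟨fun x => stabilizer_isOpen_of_isIntegral x,
    fun x => IsSepClosed.exists_pow_nat_eq x 2, h2'⟩

/-- Elements of `Kˣ` as units of the fixed field of a subgroup of the Galois group. -/
def unitsToFixed (Δ : Subgroup (Ks ≃ₐ[K] Ks)) (a : Kˣ) : (FixedPoints.subfield Δ Ks)ˣ :=
  Units.map ((algebraMap K Ks).codRestrict (FixedPoints.subfield Δ Ks)
    fun x σ => σ.1.commutes x).toMonoidHom a

theorem contH1Res_kummerClass [IsSepClosure K Ks] [IsDiscreteQuadClosed (Ks ≃ₐ[K] Ks) Ks]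
    (Δ : Subgroup (Ks ≃ₐ[K] Ks)) (a : Kˣ) :
    contH1Res Δ (kummerClass Ks a) = fixedKummer (unitsToFixed Δ a) := rfl

namespace IsGaloisAlgebra

/-- A geometric point can be chosen such that a given Sylow `2`-subgroup of `G` has a preimage of
odd index in the Galois group. -/
theorem exists_odd_index_comap [Finite G] [IsSepClosed Ks] (hL : IsGaloisAlgebra K Ks G L)
    (S : Sylow 2 G) :
    ∃ (χ : L →ₐ[K] Ks) (φ : (Ks ≃ₐ[K] Ks) →* G), (∀ σ x, σ (χ x) = χ (φ σ • x)) ∧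
      Odd ((S : Subgroup G).comap φ).index := by
  have : Fact (Nat.Prime 2) := ⟨Nat.prime_two⟩
  obtain ⟨χ⟩ := hL.nonempty_algHom
  obtain ⟨φ, hφ⟩ := hL.exists_monoidHom χ
  let _ : MulAction (Ks ≃ₐ[K] Ks) (G ⧸ (S : Subgroup G)) := MulAction.compHom _ φ
  have hodd : Odd (Nat.card (G ⧸ (S : Subgroup G))) := by
    rw [← Nat.not_even_iff_odd, even_iff_two_dvd]
    exact S.not_dvd_index
  obtain ⟨x, hx⟩ := exists_odd_index_stabilizer (Γ := Ks ≃ₐ[K] Ks) hodd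
  obtain ⟨g, rfl⟩ := QuotientGroup.mk_surjective x
  -- The stabilizer of `gS` is the preimage of `gSg⁻¹`; translating `χ` by `g` conjugates `φ` and
  -- makes it the preimage of `S`.
  refine ⟨hL.translate χ g, (MulAut.conj g⁻¹).toMonoidHom.comp φ, fun σ x => ?_, ?_⟩
  · rw [translate_apply, hφ, translate_apply, ← mul_smul, ← mul_smul]
    congr 2
    change φ σ * g = g * (g⁻¹ * φ σ * g⁻¹⁻¹)
    group
  · convert! hx using 2
    ext σ
    rw [MulAction.mem_stabilizer_iff]
    change g⁻¹ * φ σ * g⁻¹⁻¹ ∈ (S : Subgroup G) ↔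
      ((φ σ * g : G) : G ⧸ (S : Subgroup G)) = (g : G ⧸ (S : Subgroup G))
    rw [eq_comm, QuotientGroup.eq, inv_inv, mul_assoc]

/-- An automorphism fixing the images under `χ` of a finite basis of `L` fixes `χ`, so `φ` sends it
to `1`. -/
theorem isOpen_comap [Finite G] [IsDiscreteQuadClosed (Ks ≃ₐ[K] Ks) Ks]
    (hL : IsGaloisAlgebra K Ks G L) {χ : L →ₐ[K] Ks} {φ : (Ks ≃ₐ[K] Ks) →* G}
    (hφ : ∀ σ x, σ (χ x) = χ (φ σ • x)) (S : Subgroup G) :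
    IsOpen (S.comap φ : Set (Ks ≃ₐ[K] Ks)) := by
  have := hL.finite
  let b := Module.finBasis K L
  let U : Subgroup (Ks ≃ₐ[K] Ks) := ⨅ i, MulAction.stabilizer (Ks ≃ₐ[K] Ks) (χ (b i))
  have hU : IsOpen (U : Set (Ks ≃ₐ[K] Ks)) := by
    rw [Subgroup.coe_iInf]
    exact isOpen_iInter_of_finite fun i => IsDiscreteQuadClosed.isOpen_stabilizer _
  refine Subgroup.isOpen_mono (fun σ hσ => ?_) hU
  have h1 : ∀ i, σ (χ (b i)) = χ (b i) := fun i => Subgroup.mem_iInf.1 hσ i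
  have h2 : σ.toAlgHom.comp χ = χ := AlgHom.toLinearMap_injective (b.ext h1)
  have h3 : φ σ = 1 := (hL.simply_transitive χ χ).unique
    (fun x => (DFunLike.congr_fun h2 x).symm.trans (hφ σ x)) fun x => by rw [one_smul]
  rw [Subgroup.mem_comap, h3]
  exact S.one_mem

/-- Over the fixed field of the preimage of a `2`-subgroup that is a product of a non-cyclic and a
nontrivial group, the Hasse-Witt invariants vanish. -/
theorem prod_ofH1_fixedKummer_eq_one [Finite G] [IsDiscreteQuadClosed (Ks ≃ₐ[K] Ks) Ks]
    (h2 : (2 : K) ≠ 0) (hL : IsGaloisAlgebra K Ks G L) {χ : L →ₐ[K] Ks}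
    {φ : (Ks ≃ₐ[K] Ks) →* G} (hφ : ∀ σ x, σ (χ x) = χ (φ σ • x)) {S : Subgroup G}
    (hS : IsPGroup 2 S) {G₁ G₂ : Subgroup S} (hprod : IsInternalDirectProduct G₁ G₂)
    (h₁ : ¬ IsCyclic G₁) (h₂ : G₂ ≠ ⊥) {n : ℕ} {a : Fin n → Kˣ}
    (ha : IsDiagonalisation (galTraceForm K L) a) :
    ∏ i, TruncClass.ofH1 (fixedKummer (unitsToFixed (S.comap φ) (a i))) = 1 := by
  classical
  have := Fintype.ofFinite G
  obtain ⟨ψ⟩ := hprod.exists_mulEquiv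
  obtain ⟨hn, v, hv, hva⟩ := ha.exists_traceForm h2
  let Δ := S.comap φ
  let φ' : Δ →* G := φ.comp Δ.subtype
  have hφ' : ∀ (σ : Δ) x, σ • χ x = χ (φ' σ • x) := fun σ x => hφ σ x
  let φS : Δ →* S := φ.subgroupComap S
  let φ₁ : Δ →* G₁ := (MonoidHom.fst G₁ G₂).comp (ψ.toMonoidHom.comp φS)
  let φ₂ : Δ →* G₂ := (MonoidHom.snd G₁ G₂).comp (ψ.toMonoidHom.comp φS)
  let ρ₂ : Δ →* Equiv.Perm (G₂ × (G ⧸ S)) :=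
    { toFun := fun σ => (leftPerm φ₂ σ).prodCongr (Equiv.refl _)
      map_one' := by ext x <;> simp
      map_mul' := fun σ τ => by ext x <;> simp }
  -- The factor `G ⧸ S`, on which `Δ` acts trivially, is grouped with `G₂`: only an even cardinality
  -- is needed there.
  let e : G ≃ G₁ × (G₂ × (G ⧸ S)) :=
    S.prodEquivOfLeftMul.trans ((ψ.toEquiv.prodCongr (Equiv.refl _)).trans
      (Equiv.prodAssoc _ _ _))
  have he : ∀ σ x, e (leftPerm φ' σ x) = (leftPerm φ₁ σ (e x).1, ρ₂ σ (e x).2) := fun σ x => by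
    change (Equiv.prodAssoc _ _ _) ((ψ.toEquiv.prodCongr (Equiv.refl _))
      (S.prodEquivOfLeftMul (φS σ * x))) = _
    rw [S.prodEquivOfLeftMul_mul]
    change ((ψ (φS σ * _)).1, (ψ (φS σ * _)).2, _) = _
    rw [map_mul]
    rfl
  have hortho : IsOrthoFamily (dotForm Ks (leftPerm φ')) (fun i => equivariantOf χ hφ' (v i))
      fun i => unitsToFixed Δ (a i) := by
    refine ⟨fun i j hij => Subtype.ext ?_, fun i => Subtype.ext ?_⟩
    · rw [hL.coe_dotForm_equivariantOf, hv i j hij, map_zero]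
      rfl
    · rw [hL.coe_dotForm_equivariantOf, hva]
      rfl
  have hP₁ : IsPGroup 2 G₁ := hS.to_subgroup G₁
  have hP₂ : IsPGroup 2 G₂ := hS.to_subgroup G₂
  refine prod_ofH1_eq_one e he (hL.span_equivariantFun_eq_top χ hφ')
    (fun σ => hP₁.sign_mulLeft h₁ (φ₁ σ)) ?_ ?_ ⟨1⟩ hortho ?_
  · rw [← Nat.card_eq_fintype_card]
    exact hP₁.four_dvd_card h₁
  · rw [Fintype.card_prod, ← Nat.card_eq_fintype_card]
    exact (hP₂.even_card ((Subgroup.nontrivial_iff_ne_bot G₂).2 h₂)).mul_right _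
  · rw [Fintype.card_fin, hn, hL.finrank_eq, Nat.card_eq_fintype_card]

end IsGaloisAlgebra

end Main

theorem proposition4p5 {K Ks G L : Type*}
    [Field K] (hK : ringChar K ≠ 2) [Field Ks] [Algebra K Ks] [IsSepClosure K Ks]
    [Group G] [Finite G] [CommRing L] [Algebra K L] [MulSemiringAction G L]
    (hL : IsGaloisAlgebra K Ks G L) (S : Sylow 2 G)
    (hS : (∃ G₁ G₂ : Subgroup S, IsInternalDirectProduct G₁ G₂ ∧ G₁ ≠ ⊥ ∧ G₂ ≠ ⊥ ∧
          (¬ IsCyclic G₁ ∨ ¬ IsCyclic G₂)) ∨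
        ((∀ x y : S, x * y = y * x) ∧ ¬ IsMetacyclic S)) :
    (∃ (n : ℕ) (a : Fin n → Kˣ), IsDiagonalisation (galTraceForm K L) a) ∧
    ∀ (n : ℕ) (a : Fin n → Kˣ), IsDiagonalisation (galTraceForm K L) a →
      hasseWittOne Ks a = 0 ∧ hasseWittTwo Ks a = 0 := by
  have h2 : (2 : K) ≠ 0 := Ring.two_ne_zero hK
  have hclosed : IsSepClosed Ks := IsSepClosure.sep_closed K
  have := isDiscreteQuadClosed_gal (Ks := Ks) h2
  refine ⟨hL.exists_isDiagonalisation h2, fun n a ha => ?_⟩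
  obtain ⟨G₁, G₂, hprod, h₁, h₂⟩ : ∃ G₁ G₂ : Subgroup S, IsInternalDirectProduct G₁ G₂ ∧
      ¬ IsCyclic G₁ ∧ G₂ ≠ ⊥ := by
    rcases hS with ⟨G₁, G₂, hprod, hne₁, hne₂, h₁ | h₂⟩ | ⟨hcomm, hmeta⟩
    · exact ⟨G₁, G₂, hprod, h₁, hne₂⟩
    · exact ⟨G₂, G₁, hprod.symm, h₂, hne₁⟩
    · exact exists_isInternalDirectProduct_of_not_isMetacyclic hcomm hmeta
  obtain ⟨χ, φ, hφ, hodd⟩ := hL.exists_odd_index_comap S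
  have hopen := hL.isOpen_comap hφ (S : Subgroup G)
  have hone := hL.prod_ofH1_fixedKummer_eq_one h2 hφ S.isPGroup' hprod h₁ h₂ ha
  constructor
  · refine contH1_eq_zero_of_res_eq_zero hodd ?_
    rw [hasseWittOne, map_sum]
    simp only [contH1Res_kummerClass]
    rw [← TruncClass.prod_one, hone, TruncClass.one_one]
  · refine contH2_eq_zero_of_res_eq_zero hopen hodd ?_
    rw [hasseWittTwo, map_sum]
    simp only [map_sum, contH2Res_cupH1, contH1Res_kummerClass]
    rw [← TruncClass.prod_univ_two, hone, TruncClass.one_two]
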